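/- Let $n\ge 2$, let $\Omega\subset\mathbb{R}^n$ be open, bounded and connected (nonempty), let $\delta>0$ and $\Omega_\delta=\bigcup_{x\in\Omega}B(x,\delta)$, and let $0<\underline\kappa<\overline\kappa<\infty$. Let $A_\delta:\mathbb{R}_+\to\mathbb{R}_+$ be a kernel such that $x\mapsto A_\delta(|x|)$ is integrable on $\mathbb{R}^n$ with $\frac1n\int_{\mathbb{R}^n}A_\delta(|x|)\,dx=1$, $A_\delta(|x|)=0$ for $x\notin B(0,\delta)$, and, for some $s\in(0,1)$ and $c_\delta>0$, $A_\delta(|x|)\ge c_\delta|x|^{-(n+2s-2)}$ for all $x\in B(0,\delta/2)\setminus\{0\}$. For $\kappa\in L^\infty(\Omega_\delta\times\Omega_\delta)$ put $$a_{\delta,\kappa}(u,v)=\int_{\Omega_\delta}\int_{\Omega_\delta}\kappa(x,x')A_\delta(|x-x'|)\frac{u(x)-u(x')}{|x-x'|}\,\frac{v(x)-v(x')}{|x-x'|}\,dx\,dx'.$$ Let $\mathcal{U}^\delta=\{u\in L^2(\Omega_\delta): a_{\delta,1}(u,u)<\infty\}$, and let $\mathcal{U}_0^\delta$ be the closure of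 $C_c^\infty(\Omega)$ (functions extended by $0$) in $\mathcal{U}^\delta$ with respect to the norm $\big(\|u\|_{L^2(\Omega_\delta)}^2+a_{\delta,1}(u,u)\big)^{1/2}$; write $\|u\|_{\mathcal{U}_0^\delta}=a_{\delta,1}(u,u)^{1/2}$. Let $$\mathcal{K}^\delta=\{\kappa\in L^\infty(\Omega_\delta\times\Omega_\delta):\ \underline\kappa\le\kappa(x,x')=\kappa(x',x)\le\overline\kappa\ \text{ for a.e. } (x,x')\}.$$ Fix $f\in L^2(\Omega)$, let $\ell(v)=\int_\Omega fv\,dx$, and for $\kappa\in\mathcal{K}^\delta$ let $\mathcal{S}_\delta(\kappa)$ be the minimizer over $v\in\mathcal{U}_0^\delta$ of $\frac12a_{\delta,\kappa}(v,v)-\ell(v)$. **Theorem.** Let $\kappa_j\in\mathcal{K}^\delta$, $j\in\mathbb{N}$, converge weak* in $L^\infty(\Omega_\delta\times\Omega_\delta)$ (the dual of $L^1(\Omega_\delta\times\Omega_\delta)$) to some $\hat\kappa\in L^\infty(\Omega_\delta\times\Omega_\delta)$. Then $\hat\kappa\in\mathcal{K}^\delta$; the states $\mathcal{S}_\delta(\kappa_j)$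 and $\mathcal{S}_\delta(\hat\kappa)$ are well defined, each being the unique $u\in\mathcal{U}_0^\delta$ such that $a_{\delta,\kappa}(u,v)=\ell(v)$ for all $v\in\mathcal{U}_0^\delta$ (with $\kappa=\kappa_j$, respectively $\kappa=\hat\kappa$); and $$\lim_{j\to\infty}\|\mathcal{S}_\delta(\kappa_j)-\mathcal{S}_\delta(\hat\kappa)\|_{L^2(\Omega_\delta)}=\lim_{j\to\infty}\|\mathcal{S}_\delta(\kappa_j)-\mathcal{S}_\delta(\hat\kappa)\|_{\mathcal{U}_0^\delta}=0.$$ -/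

import Mathlib

open MeasureTheory Filter Topology
open scoped ENNReal ContDiff

noncomputable section

namespace NonlocalDesign

/-- The radial interaction kernel `A = A_δ : ℝ₊ → ℝ₊` with horizon `δ` in dimension `n`:
`A ≥ 0`, `(1/n) ∫ A(|x|) dx = 1`, `A(|x|) = 0` outside `B(0, δ)`, and
`A(|x|) ≥ c |x|^{-(n+2s-2)}` on `B(0, δ/2) \ {0}` for some `s ∈ (0,1)`, `c > 0`. -/
structure IsKernel (n : ℕ) (δ : ℝ) (A : ℝ → ℝ) : Prop where
  nonneg : ∀ t : ℝ, 0 ≤ t → 0 ≤ A t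
  integrable : Integrable (fun x : EuclideanSpace ℝ (Fin n) => A ‖x‖) volume
  normalized : (1 / (n : ℝ)) * ∫ x : EuclideanSpace ℝ (Fin n), A ‖x‖ = 1
  support_subset :
    Function.support (fun x : EuclideanSpace ℝ (Fin n) => A ‖x‖) ⊆ Metric.ball 0 δ
  lower_bound : ∃ s c : ℝ, 0 < s ∧ s < 1 ∧ 0 < c ∧
    ∀ x : EuclideanSpace ℝ (Fin n), x ∈ Metric.ball 0 (δ / 2) → x ≠ 0 →
      c / ‖x‖ ^ ((n : ℝ) + 2 * s - 2) ≤ A ‖x‖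

/-- Lebesgue measure on `Ω_δ = ⋃_{x ∈ Ω} B(x, δ)`. -/
abbrev μδ {n : ℕ} (Ω : Set (EuclideanSpace ℝ (Fin n))) (δ : ℝ) :
    Measure (EuclideanSpace ℝ (Fin n)) :=
  volume.restrict (Metric.thickening δ Ω)

/-- Lebesgue measure on `Ω_δ × Ω_δ`. -/
abbrev μδ2 {n : ℕ} (Ω : Set (EuclideanSpace ℝ (Fin n))) (δ : ℝ) :
    Measure (EuclideanSpace ℝ (Fin n) × EuclideanSpace ℝ (Fin n)) :=
  (μδ Ω δ).prod (μδ Ω δ)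

/-- The integrand
`κ(x,x') A(|x-x'|) (u(x)-u(x'))/|x-x'| (v(x)-v(x'))/|x-x'|` of the nonlocal form. -/
def integrand {n : ℕ} (A : ℝ → ℝ)
    (κ : EuclideanSpace ℝ (Fin n) × EuclideanSpace ℝ (Fin n) → ℝ)
    (u v : EuclideanSpace ℝ (Fin n) → ℝ)
    (p : EuclideanSpace ℝ (Fin n) × EuclideanSpace ℝ (Fin n)) : ℝ :=
  κ p * A ‖p.1 - p.2‖ * ((u p.1 - u p.2) / ‖p.1 - p.2‖) * ((v p.1 - v p.2) / ‖p.1 - p.2‖)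

/-- The bilinear form `a_{δ,κ}(u,v)`. -/
def form {n : ℕ} (Ω : Set (EuclideanSpace ℝ (Fin n))) (δ : ℝ) (A : ℝ → ℝ)
    (κ : EuclideanSpace ℝ (Fin n) × EuclideanSpace ℝ (Fin n) → ℝ)
    (u v : EuclideanSpace ℝ (Fin n) → ℝ) : ℝ :=
  ∫ p, integrand A κ u v p ∂(μδ2 Ω δ)

/-- `U^δ = {u ∈ L²(Ω_δ) | a_{δ,1}(u,u) < ∞}` (the integrand is nonnegative, so finiteness of
the integral is integrability). -/
def energySpace {n : ℕ} (Ω : Set (EuclideanSpace ℝ (Fin n))) (δ : ℝ) (A : ℝ → ℝ) :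
    Set (Lp ℝ 2 (μδ Ω δ)) :=
  {u | Integrable (integrand A (fun _ => 1) u u) (μδ2 Ω δ)}

/-- `φ ∈ C_c^∞(Ω)`, extended by zero to the whole space. -/
def IsTestFunction {n : ℕ} (Ω : Set (EuclideanSpace ℝ (Fin n)))
    (φ : EuclideanSpace ℝ (Fin n) → ℝ) : Prop :=
  ContDiff ℝ ∞ φ ∧ HasCompactSupport φ ∧ tsupport φ ⊆ Ω

/-- `U_0^δ`: the closure of `C_c^∞(Ω)` in `U^δ`. The closure is taken for
`‖u‖²_{L²(Ω_δ)} + a_{δ,1}(u,u)`: the seminorm `a_{δ,1}` alone does not see constants, whereas it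
is a norm on `U_0^δ`, whose elements vanish a.e. on `Ω_δ \ Ω`. -/
def energySpace₀ {n : ℕ} (Ω : Set (EuclideanSpace ℝ (Fin n))) (δ : ℝ) (A : ℝ → ℝ) :
    Set (Lp ℝ 2 (μδ Ω δ)) :=
  {u | u ∈ energySpace Ω δ A ∧ ∃ φ : ℕ → EuclideanSpace ℝ (Fin n) → ℝ,
    (∀ k, IsTestFunction Ω (φ k)) ∧
    Tendsto (fun k => eLpNorm (fun x => φ k x - u x) 2 (μδ Ω δ)) atTop (𝓝 0) ∧
    Tendsto (fun k => form Ω δ A (fun _ => 1) (fun x => φ k x - u x) (fun x => φ k x - u x))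
      atTop (𝓝 0)}

/-- The norm of `U_0^δ`, `a_{δ,1}(u,u)^{1/2}`. -/
def energyNorm {n : ℕ} (Ω : Set (EuclideanSpace ℝ (Fin n))) (δ : ℝ) (A : ℝ → ℝ)
    (u : Lp ℝ 2 (μδ Ω δ)) : ℝ :=
  Real.sqrt (form Ω δ A (fun _ => 1) u u)

/-- The load `ℓ(v) = ∫_Ω f v`. -/
def load {n : ℕ} (Ω : Set (EuclideanSpace ℝ (Fin n)))
    (f : Lp ℝ 2 (volume.restrict Ω)) (v : EuclideanSpace ℝ (Fin n) → ℝ) : ℝ :=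
  ∫ x in Ω, f x * v x

/-- The admissible conductivities `K^δ ⊆ L^∞(Ω_δ × Ω_δ)`: symmetric, with values in
`[κlo, κhi]`, almost everywhere. -/
def admissible {n : ℕ} (Ω : Set (EuclideanSpace ℝ (Fin n))) (δ κlo κhi : ℝ) :
    Set (Lp ℝ ∞ (μδ2 Ω δ)) :=
  {κ | ∀ᵐ p ∂(μδ2 Ω δ), κlo ≤ κ p ∧ κ p = κ p.swap ∧ κ p ≤ κhi}

/-- Weak* convergence in `L^∞(Ω_δ × Ω_δ) = L¹(Ω_δ × Ω_δ)*`. -/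
def WeakStarTendsto {n : ℕ} (Ω : Set (EuclideanSpace ℝ (Fin n))) (δ : ℝ)
    (κ : ℕ → Lp ℝ ∞ (μδ2 Ω δ)) (κhat : Lp ℝ ∞ (μδ2 Ω δ)) : Prop :=
  ∀ g : Lp ℝ 1 (μδ2 Ω δ),
    Tendsto (fun j => ∫ p, κ j p * g p ∂(μδ2 Ω δ)) atTop (𝓝 (∫ p, κhat p * g p ∂(μδ2 Ω δ)))

/-- `u ∈ U_0^δ` solves the state equation `a_{δ,κ}(u,v) = ℓ(v)` for all `v ∈ U_0^δ`. -/
def IsSolution {n : ℕ} (Ω : Set (EuclideanSpace ℝ (Fin n))) (δ : ℝ) (A : ℝ → ℝ)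
    (f : Lp ℝ 2 (volume.restrict Ω)) (κ : Lp ℝ ∞ (μδ2 Ω δ)) (u : Lp ℝ 2 (μδ Ω δ)) : Prop :=
  u ∈ energySpace₀ Ω δ A ∧ ∀ v ∈ energySpace₀ Ω δ A, form Ω δ A κ u v = load Ω f v

/-- The energy functional `I_{δ,κ}(v) = a_{δ,κ}(v,v)/2 - ℓ(v)`. -/
def energy {n : ℕ} (Ω : Set (EuclideanSpace ℝ (Fin n))) (δ : ℝ) (A : ℝ → ℝ)
    (f : Lp ℝ 2 (volume.restrict Ω)) (κ : Lp ℝ ∞ (μδ2 Ω δ)) (v : Lp ℝ 2 (μδ Ω δ)) : ℝ :=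
  1 / 2 * form Ω δ A κ v v - load Ω f v

/-- The conductivity-to-state operator `S_δ(κ) = argmin_{v ∈ U_0^δ} I_{δ,κ}(v)`. -/
def state {n : ℕ} (Ω : Set (EuclideanSpace ℝ (Fin n))) (δ : ℝ) (A : ℝ → ℝ)
    (f : Lp ℝ 2 (volume.restrict Ω)) (κ : Lp ℝ ∞ (μδ2 Ω δ)) : Lp ℝ 2 (μδ Ω δ) :=
  Classical.epsilon fun u =>
    u ∈ energySpace₀ Ω δ A ∧ IsMinOn (energy Ω δ A f κ) (energySpace₀ Ω δ A) u

end NonlocalDesign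

end

/-!
Writing `∇u(x,x') = √A(|x-x'|) (u(x)-u(x'))/|x-x'|` for the nonlocal gradient, the form is
`a_{δ,κ}(u,v) = ∫ κ ∇u ∇v`. The space `U_0^δ` is identified with a closed subspace `energyGraph` of
`L²(Ω_δ) × L²(Ω_δ × Ω_δ)`, the closure of the pairs `(φ, ∇φ)` over test functions.

Existence and uniqueness of the states come from the Lax–Milgram theorem (`exists_solution`), whose
coercivity hypothesis is a Poincaré inequality (`exists_poincare`). The latter follows by
telescoping: an element of `U_0^δ`, extended by zero, has support disjoint from that of its
translate by a long enough vector `N h`, and the increments in direction `h`, averaged over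
`δ/4 < |h| < δ/2`, are controlled by the energy, since the kernel is bounded below there.

Let `u_j`, `û` be the states of `κ_j`, `κ̂`. Admissibility passes to the weak* limit
(`admissible_of_weakStarTendsto`), and coercivity together with the two state equations gives
`κlo ‖∇(u_j - û)‖² ≤ ∫ (κ̂ - κ_j) ∇û ∇(u_j - û)`. The right-hand side tends to zero
(`tendsto_formL_sub`): along a subsequence `u_j - û` converges weakly in `U_0^δ`, hence strongly in
`L²` (`tendsto_eLpNorm_sq_of_weakly_tendsto`, where the singularity `|x|^{-(n+2s-2)}` of the kernel
enters with `s > 0`), hence almost everywhere along a further subsequence, and so do the gradients.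
As `∇û ∈ L²` and the gradients are bounded in `L²`, Vitali's theorem shows that the products
`∇û ∇(u_j - û)` converge strongly in `L¹`, and they can be paired with the weak* null sequence
`κ̂ - κ_j`. No identification of the weak limit is needed.
-/

noncomputable section

namespace NonlocalDesign

variable {n : ℕ} {Ω : Set (EuclideanSpace ℝ (Fin n))} {δ : ℝ} {A : ℝ → ℝ}

/-! ### The nonlocal gradient -/

/-- The nonlocal gradient `√A(|x-x'|) (u(x)-u(x'))/|x-x'|`, a function on pairs of points. The
square root of the kernel is included so that `a_{δ,κ}(u,v)` is the `κ`-weighted `L²` pairing of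
the gradients of `u` and `v`. -/
def nlGrad (A : ℝ → ℝ) (u : EuclideanSpace ℝ (Fin n) → ℝ)
    (p : EuclideanSpace ℝ (Fin n) × EuclideanSpace ℝ (Fin n)) : ℝ :=
  √(A ‖p.1 - p.2‖) * ((u p.1 - u p.2) / ‖p.1 - p.2‖)

lemma nlGrad_sub (u v : EuclideanSpace ℝ (Fin n) → ℝ)
    (p : EuclideanSpace ℝ (Fin n) × EuclideanSpace ℝ (Fin n)) :
    nlGrad A (fun x => u x - v x) p = nlGrad A u p - nlGrad A v p := by
  simp only [nlGrad]; ring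

lemma nlGrad_add (u v : EuclideanSpace ℝ (Fin n) → ℝ)
    (p : EuclideanSpace ℝ (Fin n) × EuclideanSpace ℝ (Fin n)) :
    nlGrad A (fun x => u x + v x) p = nlGrad A u p + nlGrad A v p := by
  simp only [nlGrad]; ring

lemma nlGrad_smul (c : ℝ) (u : EuclideanSpace ℝ (Fin n) → ℝ)
    (p : EuclideanSpace ℝ (Fin n) × EuclideanSpace ℝ (Fin n)) :
    nlGrad A (fun x => c * u x) p = c * nlGrad A u p := by
  simp only [nlGrad]; ring

lemma integrand_eq (hA : IsKernel n δ A)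
    (κ : EuclideanSpace ℝ (Fin n) × EuclideanSpace ℝ (Fin n) → ℝ)
    (u v : EuclideanSpace ℝ (Fin n) → ℝ)
    (p : EuclideanSpace ℝ (Fin n) × EuclideanSpace ℝ (Fin n)) :
    integrand A κ u v p = κ p * nlGrad A u p * nlGrad A v p := by
  have h := Real.mul_self_sqrt (hA.nonneg ‖p.1 - p.2‖ (norm_nonneg _))
  simp only [integrand, nlGrad]
  nth_rewrite 1 [← h]
  ring

lemma μδ2_absolutelyContinuous :
    μδ2 Ω δ ≪ (volume : Measure (EuclideanSpace ℝ (Fin n))).prod volume :=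
  Measure.AbsolutelyContinuous.prod Measure.restrict_le_self.absolutelyContinuous
    Measure.restrict_le_self.absolutelyContinuous

lemma aestronglyMeasurable_kernel (hA : IsKernel n δ A) :
    AEStronglyMeasurable (fun p : EuclideanSpace ℝ (Fin n) × EuclideanSpace ℝ (Fin n) =>
      A ‖p.1 - p.2‖) (μδ2 Ω δ) :=
  (hA.integrable.1.comp_quasiMeasurePreserving
    (quasiMeasurePreserving_sub_of_right_invariant volume volume)).mono_ac μδ2_absolutelyContinuous

lemma aestronglyMeasurable_nlGrad (hA : IsKernel n δ A) {u : EuclideanSpace ℝ (Fin n) → ℝ}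
    (hu : AEStronglyMeasurable u (μδ Ω δ)) :
    AEStronglyMeasurable (nlGrad A u) (μδ2 Ω δ) := by
  refine (Real.continuous_sqrt.comp_aestronglyMeasurable (aestronglyMeasurable_kernel hA)).mul
    (AEStronglyMeasurable.div₀ ?_ ?_)
  · exact hu.comp_fst.sub hu.comp_snd
  · exact (measurable_fst.sub measurable_snd).norm.aestronglyMeasurable

lemma nlGrad_congr_ae {u v : EuclideanSpace ℝ (Fin n) → ℝ} (h : u =ᵐ[μδ Ω δ] v) :
    nlGrad A u =ᵐ[μδ2 Ω δ] nlGrad A v := by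
  filter_upwards [Measure.quasiMeasurePreserving_fst.ae_eq_comp h,
    Measure.quasiMeasurePreserving_snd.ae_eq_comp h] with p h1 h2
  simp only [Function.comp_apply] at h1 h2
  simp only [nlGrad, h1, h2]

lemma form_eq (hA : IsKernel n δ A)
    (κ : EuclideanSpace ℝ (Fin n) × EuclideanSpace ℝ (Fin n) → ℝ)
    (u v : EuclideanSpace ℝ (Fin n) → ℝ) :
    form Ω δ A κ u v = ∫ p, κ p * nlGrad A u p * nlGrad A v p ∂(μδ2 Ω δ) := by
  simp only [form, integrand_eq hA]

lemma form_one_eq (hA : IsKernel n δ A) (u : EuclideanSpace ℝ (Fin n) → ℝ) :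
    form Ω δ A (fun _ => 1) u u = ∫ p, nlGrad A u p ^ 2 ∂(μδ2 Ω δ) := by
  rw [form_eq hA]
  simp only [one_mul, sq]

lemma mem_energySpace_iff (hA : IsKernel n δ A) {u : Lp ℝ 2 (μδ Ω δ)} :
    u ∈ energySpace Ω δ A ↔ MemLp (nlGrad A u) 2 (μδ2 Ω δ) := by
  rw [memLp_two_iff_integrable_sq (aestronglyMeasurable_nlGrad hA (Lp.aestronglyMeasurable u))]
  simp only [energySpace, Set.mem_ofPred_eq, funext (integrand_eq hA _ _ _), one_mul, sq]

lemma isFiniteMeasure_μδ (hΩb : Bornology.IsBounded Ω) : IsFiniteMeasure (μδ Ω δ) :=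
  isFiniteMeasure_restrict.2 hΩb.thickening.measure_lt_top.ne

lemma eLpNorm_two_sq {α : Type*} {m : MeasurableSpace α} {μ : Measure α} (g : α → ℝ) :
    eLpNorm g 2 μ ^ 2 = ∫⁻ x, ‖g x‖ₑ ^ 2 ∂μ := by
  have h := eLpNorm_nnreal_pow_eq_lintegral (f := g) (μ := μ) (p := 2) (by norm_num)
  norm_num at h
  exact h

lemma eLpNorm_sq_eq_ofReal_integral {α : Type*} {m : MeasurableSpace α} {μ : Measure α}
    {g : α → ℝ} (hg : MemLp g 2 μ) : eLpNorm g 2 μ ^ 2 = ENNReal.ofReal (∫ x, g x ^ 2 ∂μ) := by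
  rw [ofReal_integral_eq_lintegral_ofReal hg.integrable_sq (ae_of_all _ fun x => sq_nonneg _)]
  rw [eLpNorm_two_sq]
  refine lintegral_congr fun x => ?_
  rw [Real.enorm_eq_ofReal_abs, ← ENNReal.ofReal_pow (abs_nonneg _), sq_abs]

/-- A test function is Lipschitz, so the square of its nonlocal gradient is bounded by a multiple
of the integrable function `A(|x-x'|)`. -/
lemma memLp_nlGrad_of_isTestFunction (hΩb : Bornology.IsBounded Ω) (hA : IsKernel n δ A)
    {φ : EuclideanSpace ℝ (Fin n) → ℝ} (hφ : IsTestFunction Ω φ) :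
    MemLp (nlGrad A φ) 2 (μδ2 Ω δ) := by
  have := isFiniteMeasure_μδ (δ := δ) hΩb
  obtain ⟨C, hC⟩ := hφ.1.lipschitzWith_of_hasCompactSupport hφ.2.1 (by simp)
  have hmeas := aestronglyMeasurable_nlGrad (Ω := Ω) hA hφ.1.continuous.aestronglyMeasurable
  have hint : Integrable (fun p : EuclideanSpace ℝ (Fin n) × EuclideanSpace ℝ (Fin n) =>
      A ‖p.1 - p.2‖) (μδ2 Ω δ) := by
    have h := Integrable.convolution_integrand (ContinuousLinearMap.mul ℝ ℝ)
      (integrable_const (μ := μδ Ω δ) (1 : ℝ)) hA.integrable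
    simp only [ContinuousLinearMap.mul_apply', one_mul] at h
    refine h.mono_measure ?_
    exact Measure.prod_mono Measure.restrict_le_self le_rfl
  rw [memLp_two_iff_integrable_sq hmeas]
  refine (hint.const_mul ((C : ℝ) ^ 2)).mono (hmeas.pow 2) (ae_of_all _ fun p => ?_)
  have hA0 := hA.nonneg ‖p.1 - p.2‖ (norm_nonneg _)
  have h1 : |(φ p.1 - φ p.2) / ‖p.1 - p.2‖| ≤ C := by
    rw [abs_div, abs_norm]
    refine div_le_of_le_mul₀ (norm_nonneg _) C.2 ?_
    have := hC.dist_le_mul p.1 p.2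
    rwa [Real.dist_eq, dist_eq_norm] at this
  rw [Real.norm_of_nonneg (sq_nonneg _), Real.norm_of_nonneg (by positivity), nlGrad, mul_pow,
    Real.sq_sqrt hA0, mul_comm]
  exact mul_le_mul_of_nonneg_right (sq_le_sq.2 (by rwa [NNReal.abs_eq])) hA0

/-! ### The energy space as a Hilbert space -/

lemma isTestFunction_zero :
    IsTestFunction Ω (fun _ => 0 : EuclideanSpace ℝ (Fin n) → ℝ) := by
  refine ⟨contDiff_const, HasCompactSupport.zero, ?_⟩
  have h : tsupport (fun _ => 0 : EuclideanSpace ℝ (Fin n) → ℝ) = ∅ :=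
    tsupport_eq_empty_iff.2 rfl
  simp [h]

lemma IsTestFunction.add {φ ψ : EuclideanSpace ℝ (Fin n) → ℝ} (hφ : IsTestFunction Ω φ)
    (hψ : IsTestFunction Ω ψ) : IsTestFunction Ω (fun x => φ x + ψ x) :=
  ⟨hφ.1.add hψ.1, hφ.2.1.add hψ.2.1,
    (tsupport_add φ ψ).trans (Set.union_subset hφ.2.2 hψ.2.2)⟩

lemma IsTestFunction.const_mul {φ : EuclideanSpace ℝ (Fin n) → ℝ} (c : ℝ)
    (hφ : IsTestFunction Ω φ) : IsTestFunction Ω (fun x => c * φ x) :=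
  ⟨contDiff_const.mul hφ.1, hφ.2.1.mul_left, (tsupport_mul_subset_right).trans hφ.2.2⟩

lemma IsTestFunction.memLp {φ : EuclideanSpace ℝ (Fin n) → ℝ} (hφ : IsTestFunction Ω φ) :
    MemLp φ 2 (μδ Ω δ) :=
  (hφ.1.continuous.memLp_of_hasCompactSupport hφ.2.1).restrict _

variable (Ω δ A) in
/-- The graph of the nonlocal gradient over the test functions, inside `L²(Ω_δ) × L²(Ω_δ²)`. -/
def testGraph : Submodule ℝ (WithLp 2 (Lp ℝ 2 (μδ Ω δ) × Lp ℝ 2 (μδ2 Ω δ))) where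
  carrier := {p | ∃ φ, IsTestFunction Ω φ ∧ p.fst =ᵐ[μδ Ω δ] φ ∧
    p.snd =ᵐ[μδ2 Ω δ] nlGrad A φ}
  zero_mem' := by
    refine ⟨_, isTestFunction_zero, Lp.coeFn_zero _ _ _, (Lp.coeFn_zero _ _ _).trans ?_⟩
    exact ae_of_all _ fun p => by simp [nlGrad]
  add_mem' := by
    rintro p q ⟨φ, hφ, h1, h2⟩ ⟨ψ, hψ, h3, h4⟩
    refine ⟨_, hφ.add hψ, (Lp.coeFn_add _ _).trans (h1.add h3), (Lp.coeFn_add _ _).trans ?_⟩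
    exact (h2.add h4).trans (ae_of_all _ fun x => (nlGrad_add _ _ x).symm)
  smul_mem' := by
    rintro c p ⟨φ, hφ, h1, h2⟩
    refine ⟨_, hφ.const_mul c, (Lp.coeFn_smul _ _).trans (h1.const_smul c),
      (Lp.coeFn_smul _ _).trans ?_⟩
    exact (h2.const_smul c).trans (ae_of_all _ fun x => (nlGrad_smul _ _ x).symm)

variable (Ω δ A) in
/-- The Hilbert space of pairs `(u, ∇u)` with `u ∈ U_0^δ` and `∇` the nonlocal gradient, realised
as the closure of the graph over the test functions. -/
def energyGraph : Submodule ℝ (WithLp 2 (Lp ℝ 2 (μδ Ω δ) × Lp ℝ 2 (μδ2 Ω δ))) :=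
  (testGraph Ω δ A).topologicalClosure

instance : CompleteSpace (energyGraph Ω δ A) :=
  (Submodule.isClosed_topologicalClosure _).completeSpace_coe

lemma exists_seq_of_mem_energyGraph {p : WithLp 2 (Lp ℝ 2 (μδ Ω δ) × Lp ℝ 2 (μδ2 Ω δ))}
    (hp : p ∈ energyGraph Ω δ A) :
    ∃ φ : ℕ → EuclideanSpace ℝ (Fin n) → ℝ, (∀ k, IsTestFunction Ω (φ k)) ∧
      Tendsto (fun k => eLpNorm (fun x => φ k x - p.fst x) 2 (μδ Ω δ)) atTop (𝓝 0) ∧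
      Tendsto (fun k => eLpNorm (fun x => nlGrad A (φ k) x - p.snd x) 2 (μδ2 Ω δ)) atTop (𝓝 0) := by
  obtain ⟨q, hq, hlim⟩ := mem_closure_iff_seq_limit.1 hp
  choose φ hφ h1 h2 using hq
  refine ⟨φ, hφ, ?_, ?_⟩
  · have h : Tendsto (fun k => (q k).fst) atTop (𝓝 p.fst) :=
      ((WithLp.fstL 2 ℝ _ _).continuous.tendsto p).comp hlim
    refine ((Lp.tendsto_Lp_iff_tendsto_eLpNorm' _ _).1 h).congr fun k => ?_
    exact eLpNorm_congr_ae ((h1 k).sub .rfl)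
  · have h : Tendsto (fun k => (q k).snd) atTop (𝓝 p.snd) :=
      ((WithLp.sndL 2 ℝ _ _).continuous.tendsto p).comp hlim
    refine ((Lp.tendsto_Lp_iff_tendsto_eLpNorm' _ _).1 h).congr fun k => ?_
    exact eLpNorm_congr_ae ((h2 k).sub .rfl)

lemma exists_subseq_tendsto_ae {α : Type*} {m : MeasurableSpace α} {μ : Measure α}
    {f : ℕ → α → ℝ} {g : α → ℝ} (hf : ∀ k, AEStronglyMeasurable (f k) μ)
    (hg : AEStronglyMeasurable g μ)
    (h : Tendsto (fun k => eLpNorm (fun x => f k x - g x) 2 μ) atTop (𝓝 0)) :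
    ∃ ns : ℕ → ℕ, StrictMono ns ∧ ∀ᵐ x ∂μ, Tendsto (fun k => f (ns k) x) atTop (𝓝 (g x)) :=
  (tendstoInMeasure_of_tendsto_eLpNorm two_ne_zero hf hg h).exists_seq_tendsto_ae

lemma tendsto_nlGrad_ae {u : ℕ → EuclideanSpace ℝ (Fin n) → ℝ}
    {v : EuclideanSpace ℝ (Fin n) → ℝ}
    (h : ∀ᵐ x ∂μδ Ω δ, Tendsto (fun k => u k x) atTop (𝓝 (v x))) :
    ∀ᵐ p ∂μδ2 Ω δ, Tendsto (fun k => nlGrad A (u k) p) atTop (𝓝 (nlGrad A v p)) := by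
  filter_upwards [Measure.quasiMeasurePreserving_fst.ae h,
    Measure.quasiMeasurePreserving_snd.ae h] with p h1 h2
  exact ((h1.sub h2).div_const _).const_mul _

/-- The nonlocal gradient is a closed operator. -/
lemma snd_ae_eq_nlGrad (hA : IsKernel n δ A)
    {p : WithLp 2 (Lp ℝ 2 (μδ Ω δ) × Lp ℝ 2 (μδ2 Ω δ))} (hp : p ∈ energyGraph Ω δ A) :
    p.snd =ᵐ[μδ2 Ω δ] nlGrad A p.fst := by
  obtain ⟨φ, hφ, h1, h2⟩ := exists_seq_of_mem_energyGraph hp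
  have hm k : AEStronglyMeasurable (φ k) (μδ Ω δ) := (hφ k).1.continuous.aestronglyMeasurable
  obtain ⟨ns, hns, hae⟩ := exists_subseq_tendsto_ae hm (Lp.aestronglyMeasurable _) h1
  obtain ⟨ms, hms, hae'⟩ := exists_subseq_tendsto_ae (fun k => aestronglyMeasurable_nlGrad hA
    (hm (ns k))) (Lp.aestronglyMeasurable _) (h2.comp hns.tendsto_atTop)
  filter_upwards [tendsto_nlGrad_ae hae, hae'] with x hx hx'
  exact tendsto_nhds_unique hx' (hx.comp hms.tendsto_atTop)

lemma form_one_tendsto_iff (hA : IsKernel n δ A) {w : ℕ → EuclideanSpace ℝ (Fin n) → ℝ}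
    (hw : ∀ k, MemLp (nlGrad A (w k)) 2 (μδ2 Ω δ)) :
    Tendsto (fun k => form Ω δ A (fun _ => 1) (w k) (w k)) atTop (𝓝 0) ↔
      Tendsto (fun k => eLpNorm (nlGrad A (w k)) 2 (μδ2 Ω δ)) atTop (𝓝 0) := by
  have h0 k : 0 ≤ ∫ p, nlGrad A (w k) p ^ 2 ∂(μδ2 Ω δ) := integral_nonneg fun p => sq_nonneg _
  simp only [form_one_eq hA]
  have h1 : Tendsto (fun k => eLpNorm (nlGrad A (w k)) 2 (μδ2 Ω δ)) atTop (𝓝 0) ↔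
      Tendsto (fun k => eLpNorm (nlGrad A (w k)) 2 (μδ2 Ω δ) ^ 2) atTop (𝓝 0) := by
    constructor
    · intro h; simpa using ENNReal.Tendsto.pow (n := 2) h
    · intro h
      have := (ENNReal.continuous_rpow_const (y := 1 / 2)).continuousAt.tendsto.comp h
      simp only [Function.comp_def] at this
      rw [ENNReal.zero_rpow_of_pos (by norm_num)] at this
      refine this.congr fun k => ?_
      rw [← ENNReal.rpow_natCast, ← ENNReal.rpow_mul]
      norm_num
  rw [h1]
  simp only [eLpNorm_sq_eq_ofReal_integral (hw _)]
  constructor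
  · intro h; simpa using ENNReal.tendsto_ofReal h
  · intro h
    have := (ENNReal.tendsto_toReal ENNReal.zero_ne_top).comp h
    simpa [Function.comp_def, ENNReal.toReal_ofReal (h0 _)] using this

lemma fst_mem_energySpace₀ (hΩb : Bornology.IsBounded Ω) (hA : IsKernel n δ A)
    {p : WithLp 2 (Lp ℝ 2 (μδ Ω δ) × Lp ℝ 2 (μδ2 Ω δ))} (hp : p ∈ energyGraph Ω δ A) :
    p.fst ∈ energySpace₀ Ω δ A := by
  obtain ⟨φ, hφ, h1, h2⟩ := exists_seq_of_mem_energyGraph hp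
  have hpp := snd_ae_eq_nlGrad hA hp
  have hmem : MemLp (nlGrad A p.fst) 2 (μδ2 Ω δ) := (memLp_congr_ae hpp).1 (Lp.memLp _)
  refine ⟨(mem_energySpace_iff hA).2 hmem, φ, hφ, h1, ?_⟩
  have hsub k : nlGrad A (fun x => φ k x - p.fst x) = nlGrad A (φ k) - nlGrad A p.fst :=
    funext fun x => nlGrad_sub _ _ _
  refine (form_one_tendsto_iff hA fun k => ?_).2 (h2.congr fun k => ?_)
  · rw [hsub]
    exact (memLp_nlGrad_of_isTestFunction hΩb hA (hφ k)).sub hmem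
  · rw [hsub]
    exact eLpNorm_congr_ae (EventuallyEq.rfl.sub hpp)

lemma exists_mem_energyGraph (hΩb : Bornology.IsBounded Ω) (hA : IsKernel n δ A)
    {u : Lp ℝ 2 (μδ Ω δ)} (hu : u ∈ energySpace₀ Ω δ A) :
    ∃ p ∈ energyGraph Ω δ A, p.fst = u := by
  obtain ⟨hu, φ, hφ, h1, h2⟩ := hu
  have hmem := (mem_energySpace_iff hA).1 hu
  have hG k := memLp_nlGrad_of_isTestFunction (δ := δ) hΩb hA (hφ k)
  have hsub k : nlGrad A (fun x => φ k x - u x) = nlGrad A (φ k) - nlGrad A u :=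
    funext fun x => nlGrad_sub _ _ _
  rw [form_one_tendsto_iff hA fun k => by rw [hsub]; exact (hG k).sub hmem] at h2
  refine ⟨WithLp.toLp 2 (u, hmem.toLp _), ?_, rfl⟩
  refine mem_closure_iff_seq_limit.2
    ⟨fun k => WithLp.toLp 2 ((hφ k).memLp.toLp (φ k), (hG k).toLp (nlGrad A (φ k))),
      fun k => ?_, ?_⟩
  · exact ⟨φ k, hφ k, (hφ k).memLp.coeFn_toLp, (hG k).coeFn_toLp⟩
  · refine ((WithLp.prod_continuous_toLp 2 _ _).tendsto _).comp (Tendsto.prodMk_nhds ?_ ?_)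
    · refine (Lp.tendsto_Lp_iff_tendsto_eLpNorm' _ _).2 (h1.congr fun k => ?_)
      exact eLpNorm_congr_ae ((MemLp.coeFn_toLp _).symm.sub .rfl)
    · refine (Lp.tendsto_Lp_iff_tendsto_eLpNorm' _ _).2 (h2.congr fun k => ?_)
      rw [hsub]
      exact eLpNorm_congr_ae ((MemLp.coeFn_toLp _).symm.sub (MemLp.coeFn_toLp _).symm)

/-- Elements of `U_0^δ` vanish outside `Ω`. -/
lemma ae_eq_zero_of_notMem (hΩo : IsOpen Ω) {u : Lp ℝ 2 (μδ Ω δ)}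
    (hu : u ∈ energySpace₀ Ω δ A) : ∀ᵐ x ∂μδ Ω δ, x ∉ Ω → u x = 0 := by
  obtain ⟨-, φ, hφ, h1, -⟩ := hu
  have h0 : eLpNorm u 2 ((μδ Ω δ).restrict Ωᶜ) = 0 := by
    refine le_antisymm (ge_of_tendsto' h1 fun k => ?_) bot_le
    refine le_trans (le_of_eq ?_) (eLpNorm_restrict_le _ _ _ Ωᶜ)
    rw [← eLpNorm_neg]
    refine eLpNorm_congr_ae ((ae_restrict_iff' hΩo.measurableSet.compl).2 (ae_of_all _ ?_))
    intro x hx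
    have : φ k x = 0 := image_eq_zero_of_notMem_tsupport fun h => hx ((hφ k).2.2 h)
    simp [this]
  rw [eLpNorm_eq_zero_iff (Lp.aestronglyMeasurable _).restrict two_ne_zero] at h0
  exact (ae_restrict_iff' hΩo.measurableSet.compl).1 h0

/-! ### The Poincaré inequality -/

/-- Near the diagonal, the lower bound of the kernel controls differences by the nonlocal
gradient, with a constant of order `ε^{n+2s}`. -/
lemma sq_sub_le_nlGrad_sq {s c ε : ℝ} (hs : 0 < s) (hc : 0 < c) (hε : 0 < ε)
    (hεδ : ε ≤ δ / 2)
    (hlow : ∀ x : EuclideanSpace ℝ (Fin n), x ∈ Metric.ball 0 (δ / 2) → x ≠ 0 →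
      c / ‖x‖ ^ ((n : ℝ) + 2 * s - 2) ≤ A ‖x‖)
    (u : EuclideanSpace ℝ (Fin n) → ℝ) (x y : EuclideanSpace ℝ (Fin n)) (hxy : ‖x - y‖ < ε) :
    (u x - u y) ^ 2 ≤ ε ^ ((n : ℝ) + 2 * s) / c * nlGrad A u (x, y) ^ 2 := by
  rcases eq_or_ne x y with rfl | hne
  · simp only [sub_self, ne_eq, OfNat.ofNat_ne_zero, not_false_eq_true, zero_pow]
    positivity
  have ht : 0 < ‖x - y‖ := norm_pos_iff.2 (sub_ne_zero.2 hne)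
  have hA := hlow (x - y) (by simpa using hxy.trans_le hεδ) (sub_ne_zero.2 hne)
  have hpow : 0 < ‖x - y‖ ^ ((n : ℝ) + 2 * s - 2) := Real.rpow_pos_of_pos ht _
  have hA0 : 0 ≤ A ‖x - y‖ := le_trans (by positivity) hA
  rw [div_le_iff₀ hpow] at hA
  have hle : ‖x - y‖ ^ 2 ≤ ε ^ ((n : ℝ) + 2 * s) / c * A ‖x - y‖ := by
    rw [div_mul_eq_mul_div, le_div_iff₀ hc]
    calc ‖x - y‖ ^ 2 * c
        ≤ ‖x - y‖ ^ 2 * (A ‖x - y‖ * ‖x - y‖ ^ ((n : ℝ) + 2 * s - 2)) := by gcongr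
      _ = ‖x - y‖ ^ ((n : ℝ) + 2 * s) * A ‖x - y‖ := by
        have : ‖x - y‖ ^ ((n : ℝ) + 2 * s) =
            ‖x - y‖ ^ (2 : ℕ) * ‖x - y‖ ^ ((n : ℝ) + 2 * s - 2) := by
          rw [← Real.rpow_natCast, ← Real.rpow_add ht]
          congr 1
          push_cast
          ring
        rw [this]
        ring
      _ ≤ ε ^ ((n : ℝ) + 2 * s) * A ‖x - y‖ := by gcongr
  have heq : nlGrad A u (x, y) ^ 2 = A ‖x - y‖ * ((u x - u y) ^ 2 / ‖x - y‖ ^ 2) := by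
    rw [nlGrad, mul_pow, Real.sq_sqrt hA0, div_pow]
  rw [heq, ← mul_assoc]
  calc (u x - u y) ^ 2 = ‖x - y‖ ^ 2 * ((u x - u y) ^ 2 / ‖x - y‖ ^ 2) := by
        field_simp
    _ ≤ _ := by gcongr

lemma setLIntegral_sub_le {s c ε : ℝ} (hs : 0 < s) (hc : 0 < c) (hε : 0 < ε)
    (hεδ : ε ≤ δ / 2)
    (hlow : ∀ x : EuclideanSpace ℝ (Fin n), x ∈ Metric.ball 0 (δ / 2) → x ≠ 0 →
      c / ‖x‖ ^ ((n : ℝ) + 2 * s - 2) ≤ A ‖x‖)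
    (u : EuclideanSpace ℝ (Fin n) → ℝ) :
    ∫⁻ p in {p : EuclideanSpace ℝ (Fin n) × EuclideanSpace ℝ (Fin n) | ‖p.1 - p.2‖ < ε},
      ‖u p.1 - u p.2‖ₑ ^ 2 ∂μδ2 Ω δ ≤
      ENNReal.ofReal (ε ^ ((n : ℝ) + 2 * s) / c) * eLpNorm (nlGrad A u) 2 (μδ2 Ω δ) ^ 2 := by
  have hmeas : MeasurableSet
      {p : EuclideanSpace ℝ (Fin n) × EuclideanSpace ℝ (Fin n) | ‖p.1 - p.2‖ < ε} :=
    measurableSet_lt (measurable_fst.sub measurable_snd).norm measurable_const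
  have hofReal (t : ℝ) : ‖t‖ₑ ^ 2 = ENNReal.ofReal (t ^ 2) := by
    rw [Real.enorm_eq_ofReal_abs, ← ENNReal.ofReal_pow (abs_nonneg _), sq_abs]
  rw [eLpNorm_two_sq, ← lintegral_const_mul' _ _ ENNReal.ofReal_ne_top]
  refine (setLIntegral_mono' hmeas fun p hp => ?_).trans (setLIntegral_le_lintegral _ _)
  rw [hofReal, hofReal, ← ENNReal.ofReal_mul (by positivity)]
  exact ENNReal.ofReal_le_ofReal (sq_sub_le_nlGrad_sq hs hc hε hεδ hlow u p.1 p.2 hp)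

lemma ae_eq_indicator (hΩo : IsOpen Ω) {u : Lp ℝ 2 (μδ Ω δ)}
    (hu : u ∈ energySpace₀ Ω δ A) : u =ᵐ[μδ Ω δ] Ω.indicator u := by
  filter_upwards [ae_eq_zero_of_notMem hΩo hu] with x hx
  by_cases h : x ∈ Ω
  · simp [h]
  · simp [h, hx h]

/-- Extended by zero to the whole space, an element of `U_0^δ` has the squared `L²` norms of its
small increments integrable in the increment, with a bound by the energy. -/
lemma lintegral_increment_le (hΩo : IsOpen Ω) {s c r : ℝ} (hs : 0 < s) (hc : 0 < c)
    (hr : 0 < r) (hrδ : r ≤ δ / 2)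
    (hlow : ∀ x : EuclideanSpace ℝ (Fin n), x ∈ Metric.ball 0 (δ / 2) → x ≠ 0 →
      c / ‖x‖ ^ ((n : ℝ) + 2 * s - 2) ≤ A ‖x‖)
    {u : Lp ℝ 2 (μδ Ω δ)} (hu : u ∈ energySpace₀ Ω δ A) :
    ∫⁻ h in Metric.ball (0 : EuclideanSpace ℝ (Fin n)) r,
      eLpNorm (fun x => Ω.indicator u x - Ω.indicator u (x + h)) 2 volume ^ 2 ≤
      ENNReal.ofReal (r ^ ((n : ℝ) + 2 * s) / c) * eLpNorm (nlGrad A u) 2 (μδ2 Ω δ) ^ 2 := by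
  set U := Ω.indicator u with hU
  have hUm : Measurable U := ((Lp.stronglyMeasurable u).indicator hΩo.measurableSet).measurable
  set D := {p : EuclideanSpace ℝ (Fin n) × EuclideanSpace ℝ (Fin n) | ‖p.1 - p.2‖ < r} with hD
  have hDm : MeasurableSet D :=
    measurableSet_lt (measurable_fst.sub measurable_snd).norm measurable_const
  set F : EuclideanSpace ℝ (Fin n) × EuclideanSpace ℝ (Fin n) → ℝ≥0∞ :=
    D.indicator fun p => ‖U p.1 - U p.2‖ₑ ^ 2 with hF
  have hFm : Measurable F :=
    (((hUm.comp measurable_fst).sub (hUm.comp measurable_snd)).enorm.pow_const 2).indicator hDm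
  have hSm : MeasurableSet (Metric.thickening δ Ω) := Metric.isOpen_thickening.measurableSet
  have hsub {x : EuclideanSpace ℝ (Fin n)} (hx : x ∈ Ω) : x ∈ Metric.thickening δ Ω :=
    Metric.self_subset_thickening (by linarith) Ω hx
  calc
    _ = ∫⁻ h, ∫⁻ x, F (x, x + h) := by
      rw [← lintegral_indicator Metric.isOpen_ball.measurableSet]
      refine lintegral_congr fun h => ?_
      by_cases hh : h ∈ Metric.ball (0 : EuclideanSpace ℝ (Fin n)) r
      · rw [Set.indicator_of_mem hh, eLpNorm_two_sq]
        refine lintegral_congr fun x => ?_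
        rw [hF, Set.indicator_of_mem (by simpa [hD] using hh)]
      · rw [Set.indicator_of_notMem hh]
        refine Eq.symm ((lintegral_congr fun x => ?_).trans lintegral_zero)
        rw [hF, Set.indicator_of_notMem (by simpa [hD] using hh)]
    _ = ∫⁻ x, ∫⁻ h, F (x, x + h) := by
      refine lintegral_lintegral_swap (Measurable.aemeasurable ?_)
      exact hFm.comp (measurable_snd.prodMk (measurable_snd.add measurable_fst))
    _ = ∫⁻ x, ∫⁻ y, F (x, y) := by
      refine lintegral_congr fun x => ?_
      exact lintegral_add_left_eq_self (fun y => F (x, y)) x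
    _ = ∫⁻ p, F p ∂(volume.prod volume) := (lintegral_prod _ hFm.aemeasurable).symm
    _ ≤ ∫⁻ p, F p ∂μδ2 Ω δ := by
      rw [μδ2, μδ, Measure.prod_restrict, ← lintegral_indicator (hSm.prod hSm)]
      refine lintegral_mono fun p => ?_
      by_cases hp : p ∈ Metric.thickening δ Ω ×ˢ Metric.thickening δ Ω
      · rw [Set.indicator_of_mem hp]
      -- if one of two points at distance less than `δ` lies in `Ω`, both lie in `Ω_δ`
      · refine le_of_eq_of_le ?_ zero_le
        by_cases hpD : p ∈ D
        · have hpD' : dist p.1 p.2 < δ := by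
            rw [dist_eq_norm]; exact lt_of_lt_of_le hpD (by linarith)
          have h1 : p.1 ∉ Ω := fun h => hp ⟨hsub h,
            Metric.mem_thickening_iff.2 ⟨p.1, h, by rwa [dist_comm]⟩⟩
          have h2 : p.2 ∉ Ω := fun h => hp ⟨Metric.mem_thickening_iff.2 ⟨p.2, h, hpD'⟩, hsub h⟩
          rw [hF, Set.indicator_of_mem hpD]
          simp [hU, h1, h2]
        · rw [hF, Set.indicator_of_notMem hpD]
    _ = ∫⁻ p in D, ‖U p.1 - U p.2‖ₑ ^ 2 ∂μδ2 Ω δ := lintegral_indicator hDm _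
    _ ≤ _ := setLIntegral_sub_le hs hc hr hrδ hlow U
    _ = _ := by rw [eLpNorm_congr_ae (nlGrad_congr_ae (ae_eq_indicator hΩo hu))]

lemma eLpNorm_sub_translate_le {U : EuclideanSpace ℝ (Fin n) → ℝ} (hU : Measurable U)
    (h : EuclideanSpace ℝ (Fin n)) (N : ℕ) :
    eLpNorm (fun x => U x - U (x + (N : ℝ) • h)) 2 volume ≤
      N * eLpNorm (fun x => U x - U (x + h)) 2 volume := by
  induction N with
  | zero => simp
  | succ N ih =>
    have htr : Measurable fun x => U (x + (N : ℝ) • h) := hU.comp (measurable_id.add_const _)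
    have htr' : Measurable fun x => U (x + h) := hU.comp (measurable_id.add_const _)
    have hg : Measurable fun x => U x - U (x + h) := hU.sub htr'
    have h1 : eLpNorm (fun x => U (x + (N : ℝ) • h) - U (x + (N : ℝ) • h + h)) 2 volume =
        eLpNorm (fun x => U x - U (x + h)) 2 volume :=
      eLpNorm_comp_measurePreserving (g := fun x => U x - U (x + h)) hg.aestronglyMeasurable
        (measurePreserving_add_right volume ((N : ℝ) • h))
    have h2 : (fun x => U x - U (x + ((N + 1 : ℕ) : ℝ) • h)) =
        (fun x => U x - U (x + (N : ℝ) • h)) +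
          fun x => U (x + (N : ℝ) • h) - U (x + (N : ℝ) • h + h) := by
      ext x
      simp [add_smul, add_assoc]
    rw [h2]
    refine (eLpNorm_add_le (hU.sub htr).aestronglyMeasurable
      (hg.comp (measurable_id.add_const ((N : ℝ) • h))).aestronglyMeasurable (by norm_num)).trans ?_
    push_cast
    rw [add_mul, one_mul]
    exact add_le_add ih h1.le

/-- The nonlocal Poincaré inequality on `U_0^δ`. If `N|h|` exceeds the diameter of `Ω`, then `u`
and its translate by `N h` have disjoint supports, so `‖u‖ ≤ ‖u - u(· + N h)‖ ≤ N ‖u - u(· + h)‖`;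
averaging over `δ/4 < |h| < δ/2` gives the energy on the right. -/
theorem exists_poincare (hn : n ≠ 0) (hΩo : IsOpen Ω) (hΩb : Bornology.IsBounded Ω)
    (hδ : 0 < δ) (hA : IsKernel n δ A) :
    ∃ C : ℝ, 0 ≤ C ∧ ∀ u ∈ energySpace₀ Ω δ A,
      eLpNorm u 2 (μδ Ω δ) ≤ ENNReal.ofReal C * eLpNorm (nlGrad A u) 2 (μδ2 Ω δ) := by
  obtain ⟨s, c, hs, -, hc, hlow⟩ := hA.lower_bound
  obtain ⟨R, hR⟩ := hΩb.subset_ball (0 : EuclideanSpace ℝ (Fin n))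
  obtain ⟨N, hN⟩ := exists_nat_gt (2 * R / (δ / 4))
  have : Nonempty (Fin n) := ⟨⟨0, Nat.pos_of_ne_zero hn⟩⟩
  obtain ⟨h₀, hh₀⟩ := exists_norm_eq (EuclideanSpace ℝ (Fin n)) (c := 3 * δ / 8) (by positivity)
  set W : Set (EuclideanSpace ℝ (Fin n)) := Metric.ball h₀ (δ / 8)
  have hW1 {h : EuclideanSpace ℝ (Fin n)} (hh : h ∈ W) : δ / 4 < ‖h‖ := by
    have h1 := norm_sub_norm_le h₀ h
    have h2 : ‖h₀ - h‖ < δ / 8 := by rw [← dist_eq_norm, dist_comm]; exact hh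
    linarith
  have hW2 : W ⊆ Metric.ball 0 (δ / 2) := by
    refine Metric.ball_subset_ball' ?_
    rw [dist_zero_right, hh₀]
    linarith
  have hWpos : volume W ≠ 0 := (Metric.measure_ball_pos volume h₀ (by positivity)).ne'
  have hWtop : volume W ≠ ⊤ := measure_ball_lt_top.ne
  set K := ENNReal.ofReal ((δ / 2) ^ ((n : ℝ) + 2 * s) / c)
  have hKtop : (volume W)⁻¹ * ((N : ℝ≥0∞) ^ 2 * K) ≠ ⊤ :=
    ENNReal.mul_ne_top (ENNReal.inv_ne_top.2 hWpos)
      (ENNReal.mul_ne_top (by simp) ENNReal.ofReal_ne_top)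
  refine ⟨√((volume W)⁻¹ * ((N : ℝ≥0∞) ^ 2 * K)).toReal, Real.sqrt_nonneg _, fun u hu => ?_⟩
  set U := Ω.indicator u with hU
  have hUm : Measurable U := ((Lp.stronglyMeasurable u).indicator hΩo.measurableSet).measurable
  have hstep {h : EuclideanSpace ℝ (Fin n)} (hh : h ∈ W) :
      eLpNorm U 2 volume ^ 2 ≤
        (N : ℝ≥0∞) ^ 2 * eLpNorm (fun x => U x - U (x + h)) 2 volume ^ 2 := by
    rw [← mul_pow]
    gcongr
    refine le_trans (eLpNorm_mono fun x => ?_) (eLpNorm_sub_translate_le hUm h N)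
    by_cases hx : x ∈ Ω
    · have hx' : x + (N : ℝ) • h ∉ Ω := fun hx' => by
        have h1 : ‖x‖ < R := by simpa using hR hx
        have h2 : ‖x + (N : ℝ) • h‖ < R := by simpa using hR hx'
        have h3 : (N : ℝ) * ‖h‖ = ‖(N : ℝ) • h‖ := by simp [norm_smul]
        have h4 : ‖(N : ℝ) • h‖ ≤ ‖x + (N : ℝ) • h‖ + ‖x‖ := by
          simpa using norm_sub_le (x + (N : ℝ) • h) x
        rw [div_lt_iff₀ (by positivity)] at hN
        have h5 : (N : ℝ) * (δ / 4) ≤ N * ‖h‖ := by gcongr; exact (hW1 hh).le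
        linarith
      simp [hU, hx']
    · simp [hU, hx]
  have hle : volume W * eLpNorm U 2 volume ^ 2 ≤
      (N : ℝ≥0∞) ^ 2 * (K * eLpNorm (nlGrad A u) 2 (μδ2 Ω δ) ^ 2) := by
    calc volume W * eLpNorm U 2 volume ^ 2 = ∫⁻ _ in W, eLpNorm U 2 volume ^ 2 := by
          rw [setLIntegral_const, mul_comm]
      _ ≤ ∫⁻ h in W, (N : ℝ≥0∞) ^ 2 * eLpNorm (fun x => U x - U (x + h)) 2 volume ^ 2 :=
          setLIntegral_mono' Metric.isOpen_ball.measurableSet fun h hh => hstep hh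
      _ ≤ ∫⁻ h in Metric.ball 0 (δ / 2),
            (N : ℝ≥0∞) ^ 2 * eLpNorm (fun x => U x - U (x + h)) 2 volume ^ 2 :=
          lintegral_mono_set hW2
      _ ≤ _ := by
          rw [lintegral_const_mul' _ _ (by simp)]
          gcongr
          exact lintegral_increment_le hΩo hs hc (by positivity) le_rfl hlow hu
  have hsq : eLpNorm U 2 volume ^ 2 ≤ (volume W)⁻¹ * ((N : ℝ≥0∞) ^ 2 * K) *
      eLpNorm (nlGrad A u) 2 (μδ2 Ω δ) ^ 2 := by
    calc eLpNorm U 2 volume ^ 2 = (volume W)⁻¹ * (volume W * eLpNorm U 2 volume ^ 2) := by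
          rw [← mul_assoc, ENNReal.inv_mul_cancel hWpos hWtop, one_mul]
      _ ≤ _ := by
          rw [mul_assoc, mul_assoc]
          gcongr
  have hle' : eLpNorm u 2 (μδ Ω δ) ≤ eLpNorm U 2 volume := by
    rw [eLpNorm_congr_ae (ae_eq_indicator hΩo hu)]
    exact eLpNorm_restrict_le _ _ _ _
  refine hle'.trans ?_
  rw [← ENNReal.pow_le_pow_left_iff two_ne_zero, mul_pow, ← ENNReal.ofReal_pow (Real.sqrt_nonneg _),
    Real.sq_sqrt ENNReal.toReal_nonneg, ENNReal.ofReal_toReal hKtop]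
  exact hsq

/-! ### Compactness of the embedding into `L²` -/

/-- By the Cauchy–Schwarz inequality, the squared distance of a number `t` to the mean of `g` is at
most the mean of `|t - g|²`. -/
lemma enorm_sub_average_sq_le {α : Type*} {m : MeasurableSpace α} {μ : Measure α}
    [IsFiniteMeasure μ] (hμ : μ Set.univ ≠ 0) {g : α → ℝ} (hg : Integrable g μ) (t : ℝ) :
    ‖t - (μ.real Set.univ)⁻¹ * ∫ y, g y ∂μ‖ₑ ^ 2 ≤
      (μ Set.univ)⁻¹ * ∫⁻ y, ‖t - g y‖ₑ ^ 2 ∂μ := by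
  have htop := measure_ne_top μ Set.univ
  have hreal : μ.real Set.univ ≠ 0 := (ENNReal.toReal_pos hμ htop).ne'
  have h1 : t - (μ.real Set.univ)⁻¹ * ∫ y, g y ∂μ =
      (μ.real Set.univ)⁻¹ * ∫ y, (t - g y) ∂μ := by
    rw [integral_sub (integrable_const t) hg, integral_const, smul_eq_mul, mul_sub,
      inv_mul_cancel_left₀ hreal]
  have h2 : ‖(μ.real Set.univ)⁻¹‖ₑ = (μ Set.univ)⁻¹ := by
    rw [enorm_inv hreal, Real.enorm_of_nonneg measureReal_nonneg, ofReal_measureReal]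
  have h3 : ‖∫ y, (t - g y) ∂μ‖ₑ ≤
      eLpNorm (fun y => t - g y) 2 μ * (μ Set.univ) ^ (1 / 2 : ℝ) := by
    refine (enorm_integral_le_lintegral_enorm _).trans ?_
    rw [← eLpNorm_one_eq_lintegral_enorm]
    refine (eLpNorm_le_eLpNorm_mul_rpow_measure_univ one_le_two
      ((integrable_const t).sub hg).1).trans (le_of_eq ?_)
    norm_num
    rfl
  rw [h1, enorm_mul, h2, mul_pow]
  calc (μ Set.univ)⁻¹ ^ 2 * ‖∫ y, (t - g y) ∂μ‖ₑ ^ 2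
      ≤ (μ Set.univ)⁻¹ ^ 2 *
        (eLpNorm (fun y => t - g y) 2 μ * (μ Set.univ) ^ (1 / 2 : ℝ)) ^ 2 := by gcongr
    _ = (μ Set.univ)⁻¹ * ((μ Set.univ)⁻¹ * μ Set.univ) * ∫⁻ y, ‖t - g y‖ₑ ^ 2 ∂μ := by
      have h4 : ((μ Set.univ) ^ (1 / 2 : ℝ)) ^ 2 = μ Set.univ := by
        rw [← ENNReal.rpow_natCast, ← ENNReal.rpow_mul]
        norm_num
      rw [mul_pow, h4, eLpNorm_two_sq]
      ring
    _ = _ := by rw [ENNReal.inv_mul_cancel hμ htop, mul_one]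

/-- The mean of `u` over the ball of radius `ε` around `x`, for `x ∈ Ω` and `ε ≤ δ`. -/
def ballMean (Ω : Set (EuclideanSpace ℝ (Fin n))) (δ ε : ℝ) (u : EuclideanSpace ℝ (Fin n) → ℝ)
    (x : EuclideanSpace ℝ (Fin n)) : ℝ :=
  (volume.real (Metric.ball (0 : EuclideanSpace ℝ (Fin n)) ε))⁻¹ *
    ∫ y in Metric.ball x ε, u y ∂μδ Ω δ

/-- An element of `U_0^δ` is approximated in `L²(Ω)` by its means over balls of radius `ε`, with an
error of order `ε^s` in terms of the energy norm. -/
lemma eLpNorm_sq_le_ballMean (hΩo : IsOpen Ω) (hΩb : Bornology.IsBounded Ω)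
    {s c ε : ℝ} (hs : 0 < s) (hc : 0 < c)
    (hε : 0 < ε) (hεδ : ε ≤ δ / 2)
    (hlow : ∀ x : EuclideanSpace ℝ (Fin n), x ∈ Metric.ball 0 (δ / 2) → x ≠ 0 →
      c / ‖x‖ ^ ((n : ℝ) + 2 * s - 2) ≤ A ‖x‖)
    {u : Lp ℝ 2 (μδ Ω δ)} (hu : u ∈ energySpace₀ Ω δ A) :
    eLpNorm u 2 (μδ Ω δ) ^ 2 ≤
      2 * ((volume (Metric.ball (0 : EuclideanSpace ℝ (Fin n)) ε))⁻¹ *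
        (ENNReal.ofReal (ε ^ ((n : ℝ) + 2 * s) / c) * eLpNorm (nlGrad A u) 2 (μδ2 Ω δ) ^ 2)) +
      2 * ∫⁻ x in Ω, ‖ballMean Ω δ ε u x‖ₑ ^ 2 := by
  have := isFiniteMeasure_μδ (δ := δ) hΩb
  set b := volume (Metric.ball (0 : EuclideanSpace ℝ (Fin n)) ε) with hb
  have hum : Measurable u := (Lp.stronglyMeasurable u).measurable
  set D := {p : EuclideanSpace ℝ (Fin n) × EuclideanSpace ℝ (Fin n) | ‖p.1 - p.2‖ < ε} with hD
  have hDm : MeasurableSet D :=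
    measurableSet_lt (measurable_fst.sub measurable_snd).norm measurable_const
  have hsub : Ω ⊆ Metric.thickening δ Ω := Metric.self_subset_thickening (by linarith) Ω
  have huint : Integrable u (μδ Ω δ) := (Lp.memLp u).integrable one_le_two
  set J : EuclideanSpace ℝ (Fin n) → ℝ≥0∞ := fun x =>
    ∫⁻ y in Metric.ball x ε, ‖u x - u y‖ₑ ^ 2 ∂μδ Ω δ with hJ
  have hpt : ∀ x ∈ Ω, ‖u x‖ₑ ^ 2 ≤ 2 * (b⁻¹ * J x) + 2 * ‖ballMean Ω δ ε u x‖ₑ ^ 2 := by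
    intro x hx
    have hball : (μδ Ω δ).restrict (Metric.ball x ε) Set.univ = b := by
      rw [Measure.restrict_apply_univ, Measure.restrict_apply Metric.isOpen_ball.measurableSet,
        Set.inter_eq_self_of_subset_left, hb]
      · exact Measure.addHaar_ball_center volume x ε
      · exact (Metric.ball_subset_ball (by linarith)).trans (Metric.ball_subset_thickening hx δ)
    have hne : (μδ Ω δ).restrict (Metric.ball x ε) Set.univ ≠ 0 := by
      rw [hball]; exact (Metric.measure_ball_pos volume _ hε).ne'
    have h := enorm_sub_average_sq_le hne (huint.restrict (s := Metric.ball x ε)) (u x)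
    rw [Measure.real, hball] at h
    calc ‖u x‖ₑ ^ 2 = ‖(u x - ballMean Ω δ ε u x) + ballMean Ω δ ε u x‖ₑ ^ 2 := by
          rw [sub_add_cancel]
      _ ≤ (‖u x - ballMean Ω δ ε u x‖ₑ + ‖ballMean Ω δ ε u x‖ₑ) ^ 2 := by
          gcongr; exact enorm_add_le _ _
      _ ≤ 2 * (‖u x - ballMean Ω δ ε u x‖ₑ ^ 2 + ‖ballMean Ω δ ε u x‖ₑ ^ 2) := by
          have := ENNReal.rpow_add_le_mul_rpow_add_rpow ‖u x - ballMean Ω δ ε u x‖ₑ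
            ‖ballMean Ω δ ε u x‖ₑ (p := 2) one_le_two
          norm_num at this
          exact this
      _ ≤ _ := by
          rw [mul_add]
          gcongr
          exact h
  have hFm : Measurable (D.indicator fun p => ‖u p.1 - u p.2‖ₑ ^ 2) :=
    (((hum.comp measurable_fst).sub (hum.comp measurable_snd)).enorm.pow_const 2).indicator hDm
  have hJF (x : EuclideanSpace ℝ (Fin n)) :
      J x = ∫⁻ y, D.indicator (fun p => ‖u p.1 - u p.2‖ₑ ^ 2) (x, y) ∂μδ Ω δ := by
    simp only [hJ]
    rw [← lintegral_indicator Metric.isOpen_ball.measurableSet]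
    refine lintegral_congr fun y => ?_
    simp only [Set.indicator, hD, Metric.mem_ball, dist_eq_norm, Set.mem_ofPred_eq,
      norm_sub_rev x y]
  have hJm : Measurable J := by
    rw [funext hJF]
    exact hFm.lintegral_prod_right'
  have hJle : ∫⁻ x in Ω, J x ≤
      ENNReal.ofReal (ε ^ ((n : ℝ) + 2 * s) / c) * eLpNorm (nlGrad A u) 2 (μδ2 Ω δ) ^ 2 := by
    calc ∫⁻ x in Ω, J x ≤ ∫⁻ x, J x ∂μδ Ω δ := lintegral_mono_set hsub
      _ = ∫⁻ p in D, ‖u p.1 - u p.2‖ₑ ^ 2 ∂μδ2 Ω δ := by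
          simp only [hJF]
          rw [← lintegral_indicator hDm, lintegral_prod _ hFm.aemeasurable]
      _ ≤ _ := setLIntegral_sub_le hs hc hε hεδ hlow u
  calc eLpNorm u 2 (μδ Ω δ) ^ 2 ≤ ∫⁻ x in Ω, ‖u x‖ₑ ^ 2 := by
        rw [eLpNorm_congr_ae (ae_eq_indicator hΩo hu), eLpNorm_two_sq]
        refine (setLIntegral_le_lintegral _ _).trans (le_of_eq ?_)
        rw [← lintegral_indicator hΩo.measurableSet]
        refine lintegral_congr fun x => ?_
        by_cases hx : x ∈ Ω <;> simp [hx]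
    _ ≤ ∫⁻ x in Ω, (2 * (b⁻¹ * J x) + 2 * ‖ballMean Ω δ ε u x‖ₑ ^ 2) :=
        setLIntegral_mono' hΩo.measurableSet hpt
    _ = 2 * (b⁻¹ * ∫⁻ x in Ω, J x) + 2 * ∫⁻ x in Ω, ‖ballMean Ω δ ε u x‖ₑ ^ 2 := by
        rw [lintegral_add_left ((hJm.const_mul _).const_mul _),
          lintegral_const_mul _ (hJm.const_mul _),
          lintegral_const_mul _ hJm, lintegral_const_mul' _ _ (by simp)]
    _ ≤ _ := by gcongr

lemma inner_indicator_eq {α : Type*} {m : MeasurableSpace α} {μ : Measure α} [IsFiniteMeasure μ]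
    {B : Set α} (hB : MeasurableSet B) (u : Lp ℝ 2 μ) :
    inner ℝ (indicatorConstLp 2 hB (measure_ne_top μ B) (1 : ℝ)) u = ∫ y in B, u y ∂μ :=
  L2.inner_indicatorConstLp_one hB (measure_ne_top μ B) u

lemma norm_ballMean_le (hΩb : Bornology.IsBounded Ω) (ε : ℝ) (u : Lp ℝ 2 (μδ Ω δ))
    (x : EuclideanSpace ℝ (Fin n)) :
    ‖ballMean Ω δ ε u x‖ ≤ (volume.real (Metric.ball (0 : EuclideanSpace ℝ (Fin n)) ε))⁻¹ *
      (((μδ Ω δ).real Set.univ) ^ (1 / 2 : ℝ) * ‖u‖) := by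
  have := isFiniteMeasure_μδ (δ := δ) hΩb
  rw [ballMean, norm_mul, ← inner_indicator_eq Metric.isOpen_ball.measurableSet,
    Real.norm_of_nonneg (inv_nonneg.2 measureReal_nonneg)]
  gcongr
  refine (norm_inner_le_norm _ _).trans ?_
  gcongr
  rw [norm_indicatorConstLp two_ne_zero ENNReal.ofNat_ne_top, norm_one, one_mul]
  simp only [ENNReal.toReal_ofNat]
  exact Real.rpow_le_rpow measureReal_nonneg (measureReal_mono (Set.subset_univ _)) (by norm_num)

lemma measurable_ballMean (hΩb : Bornology.IsBounded Ω) (ε : ℝ) (u : Lp ℝ 2 (μδ Ω δ)) :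
    Measurable (ballMean Ω δ ε u) := by
  have := isFiniteMeasure_μδ (δ := δ) hΩb
  have hum : Measurable u := (Lp.stronglyMeasurable u).measurable
  have hDm : MeasurableSet
      {p : EuclideanSpace ℝ (Fin n) × EuclideanSpace ℝ (Fin n) | ‖p.2 - p.1‖ < ε} :=
    measurableSet_lt (measurable_snd.sub measurable_fst).norm measurable_const
  have h := ((hum.comp measurable_snd).indicator hDm).stronglyMeasurable.integral_prod_right'
    (ν := μδ Ω δ)
  refine Measurable.const_mul ?_ _
  convert h.measurable using 2 with x
  rw [← integral_indicator Metric.isOpen_ball.measurableSet]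
  refine integral_congr_ae (ae_of_all _ fun y => ?_)
  simp [Set.indicator, dist_eq_norm]

lemma tendsto_lintegral_ballMean (hΩb : Bornology.IsBounded Ω) (ε : ℝ)
    {z : ℕ → Lp ℝ 2 (μδ Ω δ)} {M : ℝ} (hM : ∀ j, ‖z j‖ ≤ M)
    (hz : ∀ y, Tendsto (fun j => inner ℝ y (z j)) atTop (𝓝 0)) :
    Tendsto (fun j => ∫⁻ x in Ω, ‖ballMean Ω δ ε (z j) x‖ₑ ^ 2) atTop (𝓝 0) := by
  have := isFiniteMeasure_μδ (δ := δ) hΩb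
  set M' := (volume.real (Metric.ball (0 : EuclideanSpace ℝ (Fin n)) ε))⁻¹ *
      (((μδ Ω δ).real Set.univ) ^ (1 / 2 : ℝ) * M) with hM'
  have h0 : ∫⁻ x in Ω, (0 : ℝ≥0∞) = 0 := lintegral_zero
  rw [← h0]
  refine tendsto_lintegral_of_dominated_convergence (fun _ => ENNReal.ofReal M' ^ 2)
    (fun j => (measurable_ballMean hΩb ε (z j)).enorm.pow_const 2)
    (fun j => ae_of_all _ fun x => ?_) ?_ (ae_of_all _ fun x => ?_)
  · refine pow_le_pow_left' ?_ 2
    rw [← ofReal_norm]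
    refine ENNReal.ofReal_le_ofReal ((norm_ballMean_le hΩb ε (z j) x).trans ?_)
    rw [hM']
    gcongr
    exact hM j
  · rw [setLIntegral_const]
    exact ENNReal.mul_ne_top (by simp) hΩb.measure_lt_top.ne
  · have h1 : Tendsto (fun j => ballMean Ω δ ε (z j) x) atTop (𝓝 0) := by
      have h2 := (hz (indicatorConstLp 2 (s := Metric.ball x ε) Metric.isOpen_ball.measurableSet
        (measure_ne_top (μδ Ω δ) _) (1 : ℝ))).const_mul
        (volume.real (Metric.ball (0 : EuclideanSpace ℝ (Fin n)) ε))⁻¹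
      simp only [inner_indicator_eq, mul_zero] at h2
      exact h2
    have h3 := ENNReal.Tendsto.pow (n := 2) h1.enorm
    simpa using h3

/-- A sequence in `U_0^δ` with bounded energies that converges weakly to zero in `L²` converges
strongly to zero in `L²`: means over small balls approximate uniformly on bounded sets of the energy
norm, and turn weak convergence into strong convergence. -/
theorem tendsto_eLpNorm_sq_of_weakly_tendsto (hΩo : IsOpen Ω)
    (hΩb : Bornology.IsBounded Ω) (hδ : 0 < δ) (hA : IsKernel n δ A)
    {z : ℕ → Lp ℝ 2 (μδ Ω δ)} (hzU : ∀ j, z j ∈ energySpace₀ Ω δ A) {M : ℝ}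
    (hM : ∀ j, ‖z j‖ ≤ M)
    (hG : ∀ j, eLpNorm (nlGrad A (z j)) 2 (μδ2 Ω δ) ≤ ENNReal.ofReal M)
    (hz : ∀ y, Tendsto (fun j => inner ℝ y (z j)) atTop (𝓝 0)) :
    Tendsto (fun j => eLpNorm (z j) 2 (μδ Ω δ) ^ 2) atTop (𝓝 0) := by
  obtain ⟨s, c, hs, -, hc, hlow⟩ := hA.lower_bound
  set b₁ := volume (Metric.ball (0 : EuclideanSpace ℝ (Fin n)) 1) with hb₁
  have hb₁0 : b₁ ≠ 0 := (Metric.measure_ball_pos volume _ one_pos).ne'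
  have hb₁t : b₁ ≠ ⊤ := measure_ball_lt_top.ne
  -- the error of the approximation by means is `O(ε^{2s})`
  have herr {ε : ℝ} (hε : 0 < ε) :
      (volume (Metric.ball (0 : EuclideanSpace ℝ (Fin n)) ε))⁻¹ *
        ENNReal.ofReal (ε ^ ((n : ℝ) + 2 * s) / c) =
      b₁⁻¹ * ENNReal.ofReal (ε ^ (2 * s) / c) := by
    have hεn : 0 < ε ^ n := by positivity
    rw [Measure.addHaar_ball_of_pos volume _ hε, finrank_euclideanSpace_fin, ← hb₁,
      ENNReal.mul_inv (by simp [hεn]) (by simp), mul_comm _ b₁⁻¹, mul_assoc,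
      ← ENNReal.ofReal_inv_of_pos hεn, ← ENNReal.ofReal_mul (by positivity)]
    congr 2
    rw [Real.rpow_add hε, Real.rpow_natCast]
    field_simp
  have hlim : Tendsto (fun ε : ℝ => 2 * (b₁⁻¹ * ENNReal.ofReal (ε ^ (2 * s) / c) *
      ENNReal.ofReal M ^ 2)) (𝓝[>] 0) (𝓝 0) := by
    have h1 : Tendsto (fun ε : ℝ => ε ^ (2 * s) / c) (𝓝[>] 0) (𝓝 0) := by
      have h2 := (Real.continuousAt_rpow_const 0 (2 * s) (Or.inr (by positivity))).tendsto
      rw [Real.zero_rpow (by positivity)] at h2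
      simpa using (h2.mono_left nhdsWithin_le_nhds).div_const c
    have h3 := ENNReal.tendsto_ofReal h1
    rw [ENNReal.ofReal_zero] at h3
    have h4 := ENNReal.Tendsto.const_mul (a := b₁⁻¹) h3 (Or.inr (ENNReal.inv_ne_top.2 hb₁0))
    have h5 := ENNReal.Tendsto.mul_const (b := ENNReal.ofReal M ^ 2) h4 (Or.inr (by simp))
    have h6 := ENNReal.Tendsto.const_mul (a := 2) h5 (Or.inr (by simp))
    simpa using h6
  rw [ENNReal.tendsto_nhds_zero]
  intro η hη
  have hη2 : 0 < η / 2 := ENNReal.half_pos hη.ne'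
  obtain ⟨ε, hεη, hεδ, hε⟩ := ((hlim.eventually_lt_const hη2).and
    ((eventually_nhdsWithin_of_eventually_nhds (Iic_mem_nhds (half_pos hδ))).and
      self_mem_nhdsWithin)).exists
  have hε : 0 < ε := hε
  have hmean := ENNReal.Tendsto.const_mul (a := 2) (tendsto_lintegral_ballMean hΩb ε hM hz)
    (Or.inr (by simp))
  rw [mul_zero] at hmean
  filter_upwards [hmean.eventually_lt_const hη2] with j hj
  refine (eLpNorm_sq_le_ballMean hΩo hΩb hs hc hε hεδ hlow (hzU j)).trans ?_
  rw [← mul_assoc _⁻¹, herr hε, ← ENNReal.add_halves η]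
  refine add_le_add (le_trans ?_ hεη.le) hj.le
  gcongr
  exact hG j

/-! ### The state equation -/

lemma norm_le_of_eLpNorm_le {α β : Type*} {m : MeasurableSpace α} {μ : Measure α}
    {m' : MeasurableSpace β} {ν : Measure β} {f : Lp ℝ 2 μ} {g : Lp ℝ 2 ν} {C : ℝ} (hC : 0 ≤ C)
    (h : eLpNorm f 2 μ ≤ ENNReal.ofReal C * eLpNorm g 2 ν) : ‖f‖ ≤ C * ‖g‖ := by
  rw [Lp.norm_def, Lp.norm_def, ← ENNReal.toReal_ofReal hC, ← ENNReal.toReal_mul]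
  exact ENNReal.toReal_mono (ENNReal.mul_ne_top ENNReal.ofReal_ne_top (Lp.eLpNorm_ne_top g)) h

/-- The Poincaré inequality on the space of pairs `(u, ∇u)`. -/
lemma exists_norm_fst_le (hn : n ≠ 0) (hΩo : IsOpen Ω) (hΩb : Bornology.IsBounded Ω)
    (hδ : 0 < δ) (hA : IsKernel n δ A) :
    ∃ C : ℝ, 0 ≤ C ∧ ∀ p ∈ energyGraph Ω δ A, ‖p.fst‖ ≤ C * ‖p.snd‖ := by
  obtain ⟨C, hC, h⟩ := exists_poincare hn hΩo hΩb hδ hA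
  refine ⟨C, hC, fun p hp => norm_le_of_eLpNorm_le hC ?_⟩
  rw [eLpNorm_congr_ae (snd_ae_eq_nlGrad hA hp)]
  exact h _ (fst_mem_energySpace₀ hΩb hA hp)

variable (Ω δ A) in
/-- The nonlocal gradient as a bounded operator on the Hilbert space of pairs `(u, ∇u)`. -/
def gradL : energyGraph Ω δ A →L[ℝ] Lp ℝ 2 (μδ2 Ω δ) :=
  (WithLp.sndL 2 ℝ _ _).comp (energyGraph Ω δ A).subtypeL

variable (A) in
/-- The form `a_{δ,κ}` as a bounded bilinear form on the Hilbert space of pairs `(u, ∇u)`. -/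
def formL (κ : Lp ℝ ∞ (μδ2 Ω δ)) : energyGraph Ω δ A →L[ℝ] energyGraph Ω δ A →L[ℝ] ℝ :=
  (innerSL ℝ).bilinearComp
    (((ContinuousLinearMap.mul ℝ ℝ).holderL (μδ2 Ω δ) ∞ 2 2 κ).comp (gradL Ω δ A)) (gradL Ω δ A)

lemma integrable_mul_mul {α : Type*} {m : MeasurableSpace α} {μ : Measure α} (κ : Lp ℝ ∞ μ)
    (g h : Lp ℝ 2 μ) : Integrable (fun x => κ x * g x * h x) μ :=
  ((Lp.memLp g).mul (Lp.memLp κ) (r := 2)).integrable_mul (Lp.memLp h)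

lemma formL_apply (κ : Lp ℝ ∞ (μδ2 Ω δ)) (p q : energyGraph Ω δ A) :
    formL A κ p q = ∫ x, κ x * p.1.snd x * q.1.snd x ∂μδ2 Ω δ := by
  have h : formL A κ p q = inner ℝ
      ((ContinuousLinearMap.mul ℝ ℝ).holderL (μδ2 Ω δ) ∞ 2 2 κ p.1.snd) q.1.snd := rfl
  rw [h, L2.inner_def]
  refine integral_congr_ae ?_
  filter_upwards [(ContinuousLinearMap.mul ℝ ℝ).coeFn_holder (r := 2) κ p.1.snd] with x hx
  have hx' : ((ContinuousLinearMap.mul ℝ ℝ).holderL (μδ2 Ω δ) ∞ 2 2 κ p.1.snd) x =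
    κ x * p.1.snd x := hx
  rw [hx', RCLike.inner_apply, conj_trivial]
  exact mul_comm _ _

lemma formL_eq_form (hA : IsKernel n δ A) (κ : Lp ℝ ∞ (μδ2 Ω δ)) (p q : energyGraph Ω δ A) :
    formL A κ p q = form Ω δ A κ p.1.fst q.1.fst := by
  rw [formL_apply, form_eq hA]
  refine integral_congr_ae ?_
  filter_upwards [snd_ae_eq_nlGrad hA p.2, snd_ae_eq_nlGrad hA q.2] with x h1 h2
  rw [h1, h2]

lemma formL_symm (κ : Lp ℝ ∞ (μδ2 Ω δ)) (p q : energyGraph Ω δ A) :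
    formL A κ p q = formL A κ q p := by
  rw [formL_apply, formL_apply]
  exact integral_congr_ae (ae_of_all _ fun x => mul_right_comm _ _ _)

lemma le_formL {κlo κhi : ℝ} {κ : Lp ℝ ∞ (μδ2 Ω δ)} (hκ : κ ∈ admissible Ω δ κlo κhi)
    (p : energyGraph Ω δ A) : κlo * ‖p.1.snd‖ ^ 2 ≤ formL A κ p p := by
  have h1 : ‖p.1.snd‖ ^ 2 = ∫ x, p.1.snd x * p.1.snd x ∂μδ2 Ω δ := by
    rw [← real_inner_self_eq_norm_sq, L2.inner_def]
    simp [pow_two]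
  rw [h1, formL_apply, ← integral_const_mul]
  refine integral_mono_ae (((Lp.memLp p.1.snd).integrable_mul (Lp.memLp p.1.snd)).const_mul _)
    (integrable_mul_mul κ _ _) ?_
  filter_upwards [hκ] with x hx
  rw [mul_assoc]
  exact mul_le_mul_of_nonneg_right hx.1 (mul_self_nonneg _)

/-- The load is the `L²(Ω_δ)` pairing with the extension of `f` by zero. -/
lemma exists_load_eq_inner (hΩo : IsOpen Ω) (hδ : 0 < δ) (f : Lp ℝ 2 (volume.restrict Ω)) :
    ∃ F : Lp ℝ 2 (μδ Ω δ), ∀ v : Lp ℝ 2 (μδ Ω δ), load Ω f v = inner ℝ F v := by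
  have hres : (μδ Ω δ).restrict Ω = volume.restrict Ω :=
    Measure.restrict_restrict_of_subset (Metric.self_subset_thickening hδ Ω)
  have hmem : MemLp (Ω.indicator f) 2 (μδ Ω δ) := by
    rw [memLp_indicator_iff_restrict hΩo.measurableSet, hres]
    exact Lp.memLp f
  refine ⟨hmem.toLp _, fun v => ?_⟩
  have h1 : load Ω f v = ∫ x in Ω, f x * v x ∂μδ Ω δ := by rw [hres, load]
  rw [h1, L2.inner_def, ← integral_indicator hΩo.measurableSet]
  refine integral_congr_ae ?_
  filter_upwards [hmem.coeFn_toLp] with x hx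
  rw [hx]
  by_cases h : x ∈ Ω <;> simp [h, mul_comm]

lemma isCoercive_formL (hn : n ≠ 0) (hΩo : IsOpen Ω) (hΩb : Bornology.IsBounded Ω)
    (hδ : 0 < δ) (hA : IsKernel n δ A) {κlo κhi : ℝ} (hκlo : 0 < κlo) {κ : Lp ℝ ∞ (μδ2 Ω δ)}
    (hκ : κ ∈ admissible Ω δ κlo κhi) : IsCoercive (formL A κ) := by
  obtain ⟨C, hC, hP⟩ := exists_norm_fst_le hn hΩo hΩb hδ hA
  refine ⟨κlo / (C ^ 2 + 1), by positivity, fun p => le_trans ?_ (le_formL hκ p)⟩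
  have h1 : ‖p‖ ^ 2 = ‖p.1.fst‖ ^ 2 + ‖p.1.snd‖ ^ 2 := WithLp.prod_norm_sq_eq_of_L2 p.1
  have h2 : ‖p.1.fst‖ ^ 2 ≤ (C * ‖p.1.snd‖) ^ 2 := by gcongr; exact hP p.1 p.2
  rw [mul_assoc, ← sq, h1, div_mul_eq_mul_div, div_le_iff₀ (by positivity), mul_assoc]
  gcongr
  linarith

/-- A pair `(u, ∇u)` solving the state equation exists by the Lax–Milgram theorem. Its first
component is the state, because the form is symmetric and positive definite. -/
theorem exists_solution (hn : n ≠ 0) (hΩo : IsOpen Ω) (hΩb : Bornology.IsBounded Ω)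
    (hδ : 0 < δ) (hA : IsKernel n δ A) {κlo κhi : ℝ} (hκlo : 0 < κlo)
    (f : Lp ℝ 2 (volume.restrict Ω)) {κ : Lp ℝ ∞ (μδ2 Ω δ)}
    (hκ : κ ∈ admissible Ω δ κlo κhi) :
    ∃ p : energyGraph Ω δ A, p.1.fst = state Ω δ A f κ ∧
      (∀ q : energyGraph Ω δ A, formL A κ p q = load Ω f q.1.fst) ∧
      IsSolution Ω δ A f κ (state Ω δ A f κ) ∧
      ∀ w, IsSolution Ω δ A f κ w → w = state Ω δ A f κ := by
  obtain ⟨F, hF⟩ := exists_load_eq_inner hΩo hδ f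
  have hcoer := isCoercive_formL hn hΩo hΩb hδ hA hκlo hκ
  have hpos {p : energyGraph Ω δ A} (hp : formL A κ p p ≤ 0) : p = 0 := by
    obtain ⟨c, hc, h⟩ := hcoer
    have h1 := (h p).trans hp
    rw [mul_assoc] at h1
    have h2 : ‖p‖ * ‖p‖ ≤ 0 := nonpos_of_mul_nonpos_right h1 hc
    exact norm_eq_zero.1 (mul_self_eq_zero.1 (le_antisymm h2 (mul_self_nonneg _)))
  set ℓ : energyGraph Ω δ A →L[ℝ] ℝ :=
    (innerSL ℝ F).comp ((WithLp.fstL 2 ℝ _ _).comp (energyGraph Ω δ A).subtypeL) with hℓ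
  have hℓload (q : energyGraph Ω δ A) : ℓ q = load Ω f q.1.fst := (hF q.1.fst).symm
  set p := hcoer.continuousLinearEquivOfBilin.symm ((InnerProductSpace.toDual ℝ _).symm ℓ) with hp
  have hsol (q : energyGraph Ω δ A) : formL A κ p q = load Ω f q.1.fst := by
    rw [← hcoer.continuousLinearEquivOfBilin_apply, hp, ContinuousLinearEquiv.apply_symm_apply,
      InnerProductSpace.toDual_symm_apply, hℓload]
  -- the energy exceeds its value at the solution by half the form of the difference
  have hen (q : energyGraph Ω δ A) : energy Ω δ A f κ q.1.fst =
      energy Ω δ A f κ p.1.fst + 1 / 2 * formL A κ (q - p) (q - p) := by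
    have h1 := hsol q
    have h2 := hsol p
    have h3 := formL_symm κ q p
    simp only [energy, ← formL_eq_form hA, ← h1, ← h2, map_sub, sub_apply, h3]
    ring
  have hpmem := fst_mem_energySpace₀ hΩb hA p.2
  have hpmin : IsMinOn (energy Ω δ A f κ) (energySpace₀ Ω δ A) p.1.fst := by
    intro v hv
    obtain ⟨q, hq, rfl⟩ := exists_mem_energyGraph hΩb hA hv
    have h1 := hen ⟨q, hq⟩
    have h2 := (mul_nonneg hκlo.le (sq_nonneg _)).trans (le_formL hκ (⟨q, hq⟩ - p))
    simp only [Set.mem_ofPred_eq]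
    linarith
  have hstate := Classical.epsilon_spec (p := fun u => u ∈ energySpace₀ Ω δ A ∧
    IsMinOn (energy Ω δ A f κ) (energySpace₀ Ω δ A) u) ⟨_, hpmem, hpmin⟩
  have hps : p.1.fst = state Ω δ A f κ := by
    obtain ⟨q, hq, hqs⟩ := exists_mem_energyGraph hΩb hA hstate.1
    have h1 := hen ⟨q, hq⟩
    have h2 : energy Ω δ A f κ q.fst ≤ energy Ω δ A f κ p.1.fst := by
      rw [hqs]; exact hstate.2 hpmem
    have h3 : (⟨q, hq⟩ : energyGraph Ω δ A) - p = 0 := hpos (by simp only at h1; linarith)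
    have h4 : q = p.1 := congrArg Subtype.val (sub_eq_zero.1 h3)
    rw [← h4]
    exact hqs
  refine ⟨p, hps, hsol, ⟨hps ▸ hpmem, fun v hv => ?_⟩, fun w hw => ?_⟩
  · obtain ⟨q, hq, rfl⟩ := exists_mem_energyGraph hΩb hA hv
    rw [← hps, ← hsol ⟨q, hq⟩, formL_eq_form hA]
  · obtain ⟨q, hq, rfl⟩ := exists_mem_energyGraph hΩb hA hw.1
    have h3 : (⟨q, hq⟩ : energyGraph Ω δ A) - p = 0 := by
      refine hpos (le_of_eq ?_)
      have h1 := hw.2 _ (fst_mem_energySpace₀ hΩb hA ((⟨q, hq⟩ : energyGraph Ω δ A) - p).2)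
      rw [← hsol, ← formL_eq_form hA κ ⟨q, hq⟩] at h1
      rw [map_sub (formL A κ), sub_apply, h1, sub_self]
    have h4 : q = p.1 := congrArg Subtype.val (sub_eq_zero.1 h3)
    rw [h4, hps]

/-! ### Weak* limits of conductivities -/

lemma WeakStarTendsto.integral {κ : ℕ → Lp ℝ ∞ (μδ2 Ω δ)} {κhat : Lp ℝ ∞ (μδ2 Ω δ)}
    (h : WeakStarTendsto Ω δ κ κhat)
    {g : EuclideanSpace ℝ (Fin n) × EuclideanSpace ℝ (Fin n) → ℝ}
    (hg : Integrable g (μδ2 Ω δ)) :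
    Tendsto (fun j => ∫ p, κ j p * g p ∂(μδ2 Ω δ)) atTop (𝓝 (∫ p, κhat p * g p ∂(μδ2 Ω δ))) := by
  have h1 (k : Lp ℝ ∞ (μδ2 Ω δ)) :
      ∫ p, k p * (memLp_one_iff_integrable.2 hg).toLp g p ∂(μδ2 Ω δ) =
      ∫ p, k p * g p ∂(μδ2 Ω δ) := by
    refine integral_congr_ae ?_
    filter_upwards [(memLp_one_iff_integrable.2 hg).coeFn_toLp] with x hx
    rw [hx]
  simpa only [h1] using h ((memLp_one_iff_integrable.2 hg).toLp g)

lemma WeakStarTendsto.setIntegral (hΩb : Bornology.IsBounded Ω)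
    {κ : ℕ → Lp ℝ ∞ (μδ2 Ω δ)} {κhat : Lp ℝ ∞ (μδ2 Ω δ)}
    (h : WeakStarTendsto Ω δ κ κhat)
    {B : Set (EuclideanSpace ℝ (Fin n) × EuclideanSpace ℝ (Fin n))} (hB : MeasurableSet B) :
    Tendsto (fun j => ∫ p in B, κ j p ∂(μδ2 Ω δ)) atTop (𝓝 (∫ p in B, κhat p ∂(μδ2 Ω δ))) := by
  have := isFiniteMeasure_μδ (δ := δ) hΩb
  have h1 (k : Lp ℝ ∞ (μδ2 Ω δ)) : ∫ p, k p * B.indicator (fun _ => 1) p ∂(μδ2 Ω δ) =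
      ∫ p in B, k p ∂(μδ2 Ω δ) := by
    rw [← integral_indicator hB]
    refine integral_congr_ae (ae_of_all _ fun x => ?_)
    by_cases hx : x ∈ B <;> simp [hx]
  simpa only [h1] using h.integral ((integrable_const (1 : ℝ)).indicator hB)

/-- The admissible set is weak* closed: its constraints are encoded by integrals over measurable
sets, symmetry by comparing the integrals over a set and its reflection. -/
theorem admissible_of_weakStarTendsto (hΩb : Bornology.IsBounded Ω) {κlo κhi : ℝ}
    {κ : ℕ → Lp ℝ ∞ (μδ2 Ω δ)} (hκK : ∀ j, κ j ∈ admissible Ω δ κlo κhi)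
    {κhat : Lp ℝ ∞ (μδ2 Ω δ)} (hlim : WeakStarTendsto Ω δ κ κhat) :
    κhat ∈ admissible Ω δ κlo κhi := by
  have := isFiniteMeasure_μδ (δ := δ) hΩb
  have hint (k : Lp ℝ ∞ (μδ2 Ω δ)) : Integrable k (μδ2 Ω δ) := (Lp.memLp k).integrable le_top
  have hswap : MeasurePreserving Prod.swap (μδ2 Ω δ) (μδ2 Ω δ) := Measure.measurePreserving_swap
  have hswap_int (k : Lp ℝ ∞ (μδ2 Ω δ))
      {B : Set (EuclideanSpace ℝ (Fin n) × EuclideanSpace ℝ (Fin n))} :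
      ∫ p in B, k p.swap ∂(μδ2 Ω δ) = ∫ p in Prod.swap ⁻¹' B, k p ∂(μδ2 Ω δ) := by
    have h := hswap.setIntegral_preimage_emb MeasurableEquiv.prodComm.measurableEmbedding
      k (Prod.swap ⁻¹' B)
    rw [← Set.preimage_comp, Prod.swap_swap_eq, Set.preimage_id] at h
    exact h
  have hae j : ∀ᵐ p ∂(μδ2 Ω δ), κlo ≤ κ j p ∧ κ j p = κ j p.swap ∧ κ j p ≤ κhi := hκK j
  have hlo : (fun _ => κlo) ≤ᵐ[μδ2 Ω δ] κhat := by
    refine ae_le_of_forall_setIntegral_le (integrable_const _) (hint _) fun B hB _ => ?_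
    refine ge_of_tendsto' (hlim.setIntegral hΩb hB) fun j => ?_
    exact integral_mono_ae (integrable_const _) (hint _).restrict
      (ae_restrict_of_ae ((hae j).mono fun p hp => hp.1))
  have hhi : κhat ≤ᵐ[μδ2 Ω δ] (fun _ => κhi) := by
    refine ae_le_of_forall_setIntegral_le (hint _) (integrable_const _) fun B hB _ => ?_
    refine le_of_tendsto' (hlim.setIntegral hΩb hB) fun j => ?_
    exact integral_mono_ae (hint _).restrict (integrable_const _)
      (ae_restrict_of_ae ((hae j).mono fun p hp => hp.2.2))
  have hsymm : κhat =ᵐ[μδ2 Ω δ] fun p => κhat p.swap := by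
    refine Integrable.ae_eq_of_forall_setIntegral_eq _ _ (hint _)
      (hswap.integrable_comp_of_integrable (hint κhat)) fun B hB _ => ?_
    rw [hswap_int]
    refine tendsto_nhds_unique (hlim.setIntegral hΩb hB)
      ((hlim.setIntegral hΩb (measurable_swap hB)).congr fun j => ?_)
    rw [← hswap_int]
    exact integral_congr_ae (ae_restrict_of_ae ((hae j).mono fun p hp => hp.2.1.symm))
  filter_upwards [hlo, hhi, hsymm] with p h1 h2 h3 using ⟨h1, h3, h2⟩

/-! ### Convergence of the states -/

/-- Bounded sequences in a separable Hilbert space have weakly convergent subsequences. -/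
lemma exists_subseq_weakly_tendsto {H : Type*} [NormedAddCommGroup H] [InnerProductSpace ℝ H]
    [CompleteSpace H] [TopologicalSpace.SeparableSpace H] {z : ℕ → H} {M : ℝ}
    (hz : ∀ j, ‖z j‖ ≤ M) :
    ∃ w : H, ∃ ms : ℕ → ℕ, StrictMono ms ∧
      ∀ y, Tendsto (fun j => inner ℝ (z (ms j)) y) atTop (𝓝 (inner ℝ w y)) := by
  obtain ⟨a, -, ms, hms, ha⟩ := WeakDual.isSeqCompact_closedBall ℝ H 0 M
    (x := fun j => StrongDual.toWeakDual (InnerProductSpace.toDual ℝ H (z j)))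
    (fun j => by simpa using hz j)
  refine ⟨(InnerProductSpace.toDual ℝ H).symm (WeakDual.toStrongDual a), ms, hms, fun y => ?_⟩
  rw [InnerProductSpace.toDual_symm_apply]
  exact ((WeakDual.eval_continuous y).tendsto a).comp ha

lemma eLpNorm_mul_le_two_two {α : Type*} {m : MeasurableSpace α} {μ : Measure α} {g h : α → ℝ}
    (hg : AEStronglyMeasurable g μ) (hh : AEStronglyMeasurable h μ) :
    eLpNorm (fun x => g x * h x) 1 μ ≤ eLpNorm g 2 μ * eLpNorm h 2 μ := by
  have := eLpNorm_smul_le_mul_eLpNorm (p := 2) (q := 2) (r := 1) hh hg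
  exact this

/-- If `g ∈ L²` and `y_k` is bounded in `L²` and tends to zero almost everywhere, then `g y_k` tends
to zero in `L¹`: the products are uniformly integrable, so Vitali's theorem applies. -/
lemma tendsto_eLpNorm_mul_of_tendsto_ae {α : Type*} {m : MeasurableSpace α} {μ : Measure α}
    [IsFiniteMeasure μ] {g : α → ℝ} (hg : MemLp g 2 μ) {y : ℕ → α → ℝ} {M : ℝ}
    (hym : ∀ k, AEStronglyMeasurable (y k) μ)
    (hy : ∀ k, eLpNorm (y k) 2 μ ≤ ENNReal.ofReal M)
    (hae : ∀ᵐ x ∂μ, Tendsto (fun k => y k x) atTop (𝓝 0)) :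
    Tendsto (fun k => eLpNorm (fun x => g x * y k x) 1 μ) atTop (𝓝 0) := by
  have hUI : UnifIntegrable (fun k x => g x * y k x) 1 μ := by
    intro ε hε
    have hM : 0 < |M| + 1 := by positivity
    obtain ⟨η, hη, h⟩ := hg.eLpNorm_indicator_le one_le_two ENNReal.ofNat_ne_top (div_pos hε hM)
    refine ⟨η, hη, fun k B hB hBη => ?_⟩
    have h1 : B.indicator (fun x => g x * y k x) = fun x => B.indicator g x * y k x := by
      ext x
      by_cases hx : x ∈ B <;> simp [hx]
    rw [h1]
    refine (eLpNorm_mul_le_two_two (hg.1.indicator hB) (hym k)).trans ?_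
    calc eLpNorm (B.indicator g) 2 μ * eLpNorm (y k) 2 μ
        ≤ ENNReal.ofReal (ε / (|M| + 1)) * ENNReal.ofReal (|M| + 1) := by
          gcongr
          · exact h B hB hBη
          · exact (hy k).trans (ENNReal.ofReal_le_ofReal (by linarith [le_abs_self M]))
      _ = ENNReal.ofReal ε := by
          rw [← ENNReal.ofReal_mul (by positivity), div_mul_cancel₀ _ hM.ne']
  have h := tendsto_Lp_finite_of_tendsto_ae (g := fun _ => 0) le_rfl ENNReal.one_ne_top
    (fun k => hg.1.mul (hym k)) (memLp_const 0) hUI (by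
      filter_upwards [hae] with x hx
      simpa using hx.const_mul (g x))
  refine h.congr fun k => ?_
  congr 1
  ext x
  simp

lemma eLpNorm_eq_ofReal_norm {α : Type*} {m : MeasurableSpace α} {μ : Measure α} (g : Lp ℝ 2 μ) :
    eLpNorm g 2 μ = ENNReal.ofReal ‖g‖ := by
  rw [Lp.norm_def, ENNReal.ofReal_toReal (Lp.eLpNorm_ne_top g)]

instance : SecondCountableTopology (Lp ℝ 2 (μδ Ω δ)) :=
  have : Fact ((2 : ℝ≥0∞) ≠ ⊤) := ⟨ENNReal.ofNat_ne_top⟩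
  Lp.SecondCountableTopology

instance : SecondCountableTopology (Lp ℝ 2 (μδ2 Ω δ)) :=
  have : Fact ((2 : ℝ≥0∞) ≠ ⊤) := ⟨ENNReal.ofNat_ne_top⟩
  have : IsSeparable (μδ2 Ω δ) := isSeparable_of_sigmaFinite _
  Lp.SecondCountableTopology

/-- Bounded sequences in the Hilbert space of pairs `(u, ∇u)` have, after subtraction of a weak
limit, a subsequence whose gradients tend to zero almost everywhere. -/
lemma exists_subseq_grad_tendsto_ae (hΩo : IsOpen Ω) (hΩb : Bornology.IsBounded Ω)
    (hδ : 0 < δ) (hA : IsKernel n δ A) {z : ℕ → energyGraph Ω δ A} {M : ℝ}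
    (hz : ∀ j, ‖z j‖ ≤ M) :
    ∃ w : energyGraph Ω δ A, ∃ ms : ℕ → ℕ, StrictMono ms ∧
      ∀ᵐ x ∂μδ2 Ω δ, Tendsto (fun j => (z (ms j) - w).1.snd x) atTop (𝓝 0) := by
  obtain ⟨w, ms, hms, hw⟩ := exists_subseq_weakly_tendsto hz
  set y : ℕ → energyGraph Ω δ A := fun j => z (ms j) - w with hy
  have hyM j : ‖y j‖ ≤ M + ‖w‖ := (norm_sub_le _ _).trans (by gcongr; exact hz _)
  have hfst j : ‖(y j).1.fst‖ ≤ M + ‖w‖ := (WithLp.norm_fst_le (x := (y j).1)).trans (hyM j)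
  have hsnd j : ‖(y j).1.snd‖ ≤ M + ‖w‖ := (WithLp.norm_snd_le (x := (y j).1)).trans (hyM j)
  have hweak (v : Lp ℝ 2 (μδ Ω δ)) :
      Tendsto (fun j => inner ℝ v (y j).1.fst) atTop (𝓝 0) := by
    set ℓ : energyGraph Ω δ A →L[ℝ] ℝ :=
      (innerSL ℝ v).comp ((WithLp.fstL 2 ℝ _ _).comp (energyGraph Ω δ A).subtypeL) with hℓ
    have h1 (q : energyGraph Ω δ A) :
        inner ℝ q ((InnerProductSpace.toDual ℝ _).symm ℓ) = inner ℝ v q.1.fst := by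
      rw [real_inner_comm, InnerProductSpace.toDual_symm_apply]
      rfl
    have h2 := (hw ((InnerProductSpace.toDual ℝ _).symm ℓ)).sub_const
      (inner ℝ w ((InnerProductSpace.toDual ℝ _).symm ℓ))
    rw [sub_self] at h2
    refine h2.congr fun j => ?_
    rw [← inner_sub_left, h1]
  have hstrong := tendsto_eLpNorm_sq_of_weakly_tendsto hΩo hΩb hδ hA
    (fun j => fst_mem_energySpace₀ hΩb hA (y j).2) hfst (fun j => by
      rw [← eLpNorm_congr_ae (snd_ae_eq_nlGrad hA (y j).2), eLpNorm_eq_ofReal_norm]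
      exact ENNReal.ofReal_le_ofReal (hsnd j)) hweak
  obtain ⟨ns, hns, hae⟩ := exists_subseq_tendsto_ae (g := fun _ => 0)
    (fun j => Lp.aestronglyMeasurable (y j).1.fst) aestronglyMeasurable_const (by
      have h := (ENNReal.continuous_rpow_const (y := 1 / 2)).continuousAt.tendsto.comp hstrong
      simp only [Function.comp_def] at h
      rw [ENNReal.zero_rpow_of_pos (by norm_num)] at h
      refine h.congr fun k => ?_
      rw [← ENNReal.rpow_natCast, ← ENNReal.rpow_mul]
      norm_num)
  refine ⟨w, ms ∘ ns, hms.comp hns, ?_⟩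
  have hall := ae_all_iff.2 fun j => snd_ae_eq_nlGrad hA (y (ns j)).2
  filter_upwards [tendsto_nlGrad_ae (A := A) hae, hall] with x hx hx'
  have h0 : nlGrad A (fun _ : EuclideanSpace ℝ (Fin n) => (0 : ℝ)) x = 0 := by simp [nlGrad]
  rw [h0] at hx
  exact hx.congr fun j => (hx' j).symm

/-- Along conductivities converging weak*, the forms converge on a fixed first argument and a merely
bounded sequence of second arguments. -/
theorem tendsto_formL_sub (hΩo : IsOpen Ω) (hΩb : Bornology.IsBounded Ω)
    (hδ : 0 < δ) (hA : IsKernel n δ A) {κlo κhi : ℝ} (hκlo : 0 < κlo)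
    {κ : ℕ → Lp ℝ ∞ (μδ2 Ω δ)} (hκK : ∀ j, κ j ∈ admissible Ω δ κlo κhi)
    {κhat : Lp ℝ ∞ (μδ2 Ω δ)} (hκhat : κhat ∈ admissible Ω δ κlo κhi)
    (hlim : WeakStarTendsto Ω δ κ κhat) (p : energyGraph Ω δ A)
    {z : ℕ → energyGraph Ω δ A} {M : ℝ} (hz : ∀ j, ‖z j‖ ≤ M) :
    Tendsto (fun j => formL A κhat p (z j) - formL A (κ j) p (z j)) atTop (𝓝 0) := by
  have := isFiniteMeasure_μδ (δ := δ) hΩb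
  refine tendsto_of_subseq_tendsto fun ns hns => ?_
  obtain ⟨w, ms, hms, hae⟩ := exists_subseq_grad_tendsto_ae hΩo hΩb hδ hA
    (z := fun j => z (ns j)) (fun j => hz _)
  refine ⟨ms, ?_⟩
  set y : ℕ → energyGraph Ω δ A := fun j => z (ns (ms j)) - w with hy
  set Y : ℕ → ℝ := fun j => (eLpNorm (fun x => p.1.snd x * (y j).1.snd x) 1 (μδ2 Ω δ)).toReal
    with hY
  have hYlim : Tendsto Y atTop (𝓝 0) := by
    have h := tendsto_eLpNorm_mul_of_tendsto_ae (M := M + ‖w‖) (Lp.memLp p.1.snd)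
      (fun j => Lp.aestronglyMeasurable (y j).1.snd) (fun j => by
        rw [eLpNorm_eq_ofReal_norm]
        refine ENNReal.ofReal_le_ofReal ?_
        have h1 : ‖y j‖ ≤ M + ‖w‖ := (norm_sub_le _ _).trans (by gcongr; exact hz _)
        exact (WithLp.norm_snd_le (x := (y j).1)).trans h1) hae
    exact (ENNReal.tendsto_toReal ENNReal.zero_ne_top).comp h
  -- conductivities are bounded by `κhi`, so forms are bounded by the `L¹` norm of the product
  have hbd {k : Lp ℝ ∞ (μδ2 Ω δ)} (hk : k ∈ admissible Ω δ κlo κhi) (j : ℕ) :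
      |formL A k p (y j)| ≤ κhi * Y j := by
    have hprod : Integrable (fun x => p.1.snd x * (y j).1.snd x) (μδ2 Ω δ) :=
      (Lp.memLp p.1.snd).integrable_mul (Lp.memLp (y j).1.snd)
    have h1 : Y j = ∫ x, ‖p.1.snd x * (y j).1.snd x‖ ∂μδ2 Ω δ := by
      simp only [hY]
      rw [integral_norm_eq_lintegral_enorm hprod.1, eLpNorm_one_eq_lintegral_enorm]
    rw [h1, formL_apply, ← integral_const_mul, ← Real.norm_eq_abs]
    refine norm_integral_le_of_norm_le (hprod.norm.const_mul _) ?_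
    filter_upwards [hk] with x hx
    rw [mul_assoc, norm_mul, Real.norm_of_nonneg (hκlo.le.trans hx.1)]
    exact mul_le_mul_of_nonneg_right hx.2.2 (norm_nonneg _)
  have hw : Tendsto (fun j => formL A κhat p w - formL A (κ (ns (ms j))) p w) atTop (𝓝 0) := by
    have hprod : Integrable (fun x => p.1.snd x * w.1.snd x) (μδ2 Ω δ) :=
      (Lp.memLp p.1.snd).integrable_mul (Lp.memLp w.1.snd)
    have h1 := ((hlim.integral hprod).comp (hns.comp hms.tendsto_atTop)).const_sub
      (∫ x, κhat x * (p.1.snd x * w.1.snd x) ∂(μδ2 Ω δ))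
    rw [sub_self] at h1
    refine h1.congr fun j => ?_
    simp only [formL_apply, mul_assoc, Function.comp_apply]
  have hyt : Tendsto (fun j => formL A κhat p (y j) - formL A (κ (ns (ms j))) p (y j)) atTop
      (𝓝 0) := by
    refine squeeze_zero_norm (a := fun j => κhi * Y j + κhi * Y j) (fun j => ?_) ?_
    · exact (norm_sub_le _ _).trans (add_le_add (hbd hκhat j) (hbd (hκK _) j))
    · simpa using (hYlim.const_mul κhi).add (hYlim.const_mul κhi)
  refine ((hw.add hyt).congr fun j => ?_).trans (by simp)
  simp only [hy, map_sub]
  ring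

lemma energyNorm_fst (hA : IsKernel n δ A) (p : energyGraph Ω δ A) :
    energyNorm Ω δ A p.1.fst = ‖p.1.snd‖ := by
  have h : ∫ x, nlGrad A p.1.fst x ^ 2 ∂(μδ2 Ω δ) = ‖p.1.snd‖ ^ 2 := by
    rw [← real_inner_self_eq_norm_sq, L2.inner_def]
    refine integral_congr_ae ?_
    filter_upwards [snd_ae_eq_nlGrad hA p.2] with x hx
    simp [hx]
  rw [energyNorm, form_one_eq hA, h, Real.sqrt_sq (norm_nonneg _)]

end NonlocalDesign

end

open NonlocalDesign in
theorem mainTheorem4 (n : ℕ) (hn : 2 ≤ n)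
    (Ω : Set (EuclideanSpace ℝ (Fin n))) (hΩo : IsOpen Ω) (hΩb : Bornology.IsBounded Ω)
    (hΩc : IsConnected Ω)
    (δ : ℝ) (hδ : 0 < δ) (A : ℝ → ℝ) (hA : IsKernel n δ A)
    (κlo κhi : ℝ) (hκlo : 0 < κlo) (hκ : κlo < κhi)
    (f : Lp ℝ 2 (volume.restrict Ω))
    (κ : ℕ → Lp ℝ ∞ (μδ2 Ω δ)) (hκK : ∀ j, κ j ∈ admissible Ω δ κlo κhi)
    (κhat : Lp ℝ ∞ (μδ2 Ω δ)) (hlim : WeakStarTendsto Ω δ κ κhat) :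
    κhat ∈ admissible Ω δ κlo κhi ∧
    (∀ j, IsSolution Ω δ A f (κ j) (state Ω δ A f (κ j)) ∧
      ∀ w, IsSolution Ω δ A f (κ j) w → w = state Ω δ A f (κ j)) ∧
    (IsSolution Ω δ A f κhat (state Ω δ A f κhat) ∧
      ∀ w, IsSolution Ω δ A f κhat w → w = state Ω δ A f κhat) ∧
    Tendsto (fun j => ‖state Ω δ A f (κ j) - state Ω δ A f κhat‖) atTop (𝓝 0) ∧
    Tendsto (fun j => energyNorm Ω δ A (state Ω δ A f (κ j) - state Ω δ A f κhat))
      atTop (𝓝 0) := by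
  have hn0 : n ≠ 0 := by omega
  have hκhat := admissible_of_weakStarTendsto hΩb hκK hlim
  choose p hp hpsol hpst hpun using fun j => exists_solution hn0 hΩo hΩb hδ hA hκlo f (hκK j)
  obtain ⟨q, hq, hqsol, hqst, hqun⟩ := exists_solution hn0 hΩo hΩb hδ hA hκlo f hκhat
  obtain ⟨C, hC, hP⟩ := exists_norm_fst_le hn0 hΩo hΩb hδ hA
  obtain ⟨F, hF⟩ := exists_load_eq_inner hΩo hδ f
  -- the a priori bound of the states, uniform in the conductivity
  have hsnd j : ‖(p j).1.snd‖ ≤ ‖F‖ * C / κlo := by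
    have h1 := le_formL (hκK j) (p j)
    rw [hpsol, hF] at h1
    have h2 : κlo * ‖(p j).1.snd‖ ^ 2 ≤ ‖F‖ * (C * ‖(p j).1.snd‖) :=
      h1.trans ((real_inner_le_norm _ _).trans (by gcongr; exact hP _ (p j).2))
    rw [le_div_iff₀ hκlo]
    rcases (norm_nonneg (p j).1.snd).eq_or_lt with h0 | h0
    · rw [← h0]; simp only [zero_mul]; positivity
    · exact le_of_mul_le_mul_right (by linarith) h0
  set z : ℕ → energyGraph Ω δ A := fun j => p j - q with hz
  have hzM j : ‖z j‖ ≤ (C + 1) * (‖F‖ * C / κlo) + ‖q‖ := by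
    have h1 : ‖p j‖ ^ 2 = ‖(p j).1.fst‖ ^ 2 + ‖(p j).1.snd‖ ^ 2 :=
      WithLp.prod_norm_sq_eq_of_L2 (p j).1
    have h2 : ‖p j‖ ≤ ‖(p j).1.fst‖ + ‖(p j).1.snd‖ := by
      refine abs_le_of_sq_le_sq' ?_ (by positivity) |>.2
      rw [h1, add_sq]
      have := mul_nonneg (norm_nonneg (p j).1.fst) (norm_nonneg (p j).1.snd)
      linarith
    have h3 : ‖p j‖ ≤ (C + 1) * ‖(p j).1.snd‖ := by linarith [hP _ (p j).2]
    exact (norm_sub_le _ _).trans (add_le_add (h3.trans (by gcongr; exact hsnd j)) le_rfl)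
  -- by coercivity, the energy of the error is controlled by the change of conductivity at `q`
  have hkey j : κlo * ‖(z j).1.snd‖ ^ 2 ≤ formL A κhat q (z j) - formL A (κ j) q (z j) := by
    refine (le_formL (hκK j) (z j)).trans (le_of_eq ?_)
    rw [hqsol, ← hpsol j (z j), ← sub_apply, ← map_sub]
  have hgrad : Tendsto (fun j => ‖(z j).1.snd‖) atTop (𝓝 0) := by
    have h1 := (tendsto_formL_sub hΩo hΩb hδ hA hκlo hκK hκhat hlim q hzM).div_const κlo
    rw [zero_div] at h1
    have h2 : Tendsto (fun j => ‖(z j).1.snd‖ ^ 2) atTop (𝓝 0) :=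
      squeeze_zero (fun j => sq_nonneg _)
        (fun j => (le_div_iff₀ hκlo).2 (by rw [mul_comm]; exact hkey j)) h1
    simpa using h2.sqrt
  have hzst j : (z j).1.fst = state Ω δ A f (κ j) - state Ω δ A f κhat := by
    rw [← hp j, ← hq]
    rfl
  refine ⟨hκhat, fun j => ⟨hpst j, hpun j⟩, ⟨hqst, hqun⟩, ?_, ?_⟩
  · simp only [← hzst]
    refine squeeze_zero (fun j => norm_nonneg _) (fun j => hP _ (z j).2) ?_
    simpa using hgrad.const_mul C
  · simp only [← hzst, energyNorm_fst hA]
    exact hgrad
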